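/- Let $\kappa$ be a strongly inaccessible (in particular uncountable) cardinal. Generalized Sacks forcing $\mathbb{S}_\kappa$ consists of all nonempty $T\subseteq 2^{<\kappa}$ closed under initial segments such that: (1) every $u\in T$ has an extension $t\in T$ that splits in $T$, i.e. $t^\frown 0,\,t^\frown 1\in T$; (2) if $\alpha<\kappa$ is a limit ordinal, $u\in 2^\alpha$ and $u\restriction\beta\in T$ for all $\beta<\alpha$, then $u\in T$; (3) if $\alpha<\kappa$ is a limit ordinal, $u\in 2^\alpha$ and $u\restriction\beta$ splits in $T$ for arbitrarily large $\beta<\alpha$, then $u$ splits in $T$. It is ordered by inclusion: $T\le S$ iff $T\subseteq S$. For an index set $A$ (for example, a set of ordinals), let $\mathbb{S}_\kappa^A$ be the $\kappa$-support product: all functions $p:A\to\mathbb{S}_\kappa$ with $|\{\beta\in A: p(\beta)\neq 2^{<\kappa}\}|\le\kappa$, ordered coordinatewise. Let $h(\alpha)=2^{|\alpha|}$ for $\alpha<\kappa$. Then $h$ is a function from $\kappa$ to $\kappa$ with $\lim_{\alpha\to\kappa}h(\alpha)=\kappa$, and the following hold. (a) $\mathbb{S}_\kappa^A$ has the generalized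 $h$-Sacks property: for every $p\in\mathbb{S}_\kappa^A$ and every $\mathbb{S}_\kappa^A$-name $\dot f$ with $p\Vdash\dot f\in\kappa^\kappa$ there are $q\le p$ and an $h$-slalom $\varphi$ (that is, a function in the ground model with $\varphi(\alpha)\subseteq\kappa$ and $|\varphi(\alpha)|=|h(\alpha)|$ for all $\alpha<\kappa$) such that $q\Vdash\dot f(\alpha)\in\varphi(\alpha)$ for all $\alpha<\kappa$. (b) More generally, for every $p\in\mathbb{S}_\kappa^A$ and every $\mathbb{S}_\kappa^A$-name $\dot f$ such that $p$ forces $\dot f$ to be a function from $\kappa$ into the ground model $V$, there are $q\le p$ and $\varphi:\kappa\to V$ in $V$ such that $|\varphi(\alpha)|\le 2^{|\alpha|}$ and $q\Vdash\dot f(\alpha)\in\varphi(\alpha)$ for all $\alpha<\kappa$. (c) For every $p\in\mathbb{S}_\kappa^A$ and every sequence $(\mathcal{A}_\alpha:\alpha<\kappa)$ of maximal antichains in $\mathbb{S}_\kappa^A$ there are $q\le p$ and sets $\mathcal{B}_\alpha\subseteq\mathcal{A}_\alpha$ such that, for all $\alpha<\kappa$, $|\mathcal{B}_\alpha|\le 2^{|\alpha|}$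 and $\mathcal{B}_\alpha$ is predense below $q$ (every $r\le q$ is compatible with some member of $\mathcal{B}_\alpha$). -/

import Mathlib

universe u

namespace GenSacks

/-! ### Nodes and trees -/

/-- A node of `2^{<κ}`: a length `len < κ` together with a function `len → 2`.
Elements of `κ.ord.ToType` are the ordinals below `κ`; the function is stored as a function on all
of them which is (by convention) `false` from `len` onwards, so that a node is determined by `len`
and by its values below `len`. -/
structure Node (κ : Cardinal.{u}) : Type u where
  len : κ.ord.ToType
  val : κ.ord.ToType → Bool
  val_eq_false : ∀ β, len ≤ β → val β = false

namespace Node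

variable {κ : Cardinal.{u}}

/-- `u` is an initial segment of `v`, i.e. `u ⊆ v`. -/
def IsInit (u v : Node κ) : Prop :=
  u.len ≤ v.len ∧ ∀ β < u.len, u.val β = v.val β

/-- The restriction `u ↾ β`. -/
noncomputable def restrict (u : Node κ) (β : κ.ord.ToType) : Node κ where
  len := min β u.len
  val := fun γ => if γ < β then u.val γ else false
  val_eq_false := by
    intro γ hγ
    split_ifs with h
    · rcases min_le_iff.1 hγ with h' | h'
      · exact absurd h (not_lt.2 h')
      · exact u.val_eq_false γ h'
    · rfl

/-- The concatenation `u ⌢ i`, a node of length `len u + 1`. -/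
noncomputable def snoc (u : Node κ) (i : Bool) : Node κ where
  len := Order.succ u.len
  val := fun γ => if γ < Order.succ u.len then (if γ = u.len then i else u.val γ) else false
  val_eq_false := by
    intro γ hγ
    rw [if_neg (not_lt.2 hγ)]

/-- `u` splits in `T`: both `u ⌢ 0` and `u ⌢ 1` belong to `T`. -/
def Splits (T : Set (Node κ)) (u : Node κ) : Prop :=
  ∀ i : Bool, u.snoc i ∈ T

end Node

/-! ### Generalized Sacks forcing and its `κ`-support product -/

/-- Conditions of generalized Sacks forcing: nonempty subtrees of `2^{<κ}` in which every node has
a splitting extension, and which are closed under limits of nodes and under limits of splitting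
nodes. -/
structure SacksTree (κ : Cardinal.{u}) : Type u where
  carrier : Set (Node κ)
  nonempty : carrier.Nonempty
  init_mem : ∀ u ∈ carrier, ∀ v : Node κ, v.IsInit u → v ∈ carrier
  exists_splits : ∀ u ∈ carrier, ∃ t ∈ carrier, u.IsInit t ∧ Node.Splits carrier t
  limit_mem : ∀ u : Node κ, Order.IsSuccLimit u.len →
    (∀ β < u.len, u.restrict β ∈ carrier) → u ∈ carrier
  limit_splits : ∀ u : Node κ, Order.IsSuccLimit u.len →
    (∀ γ < u.len, ∃ β, γ ≤ β ∧ β < u.len ∧ Node.Splits carrier (u.restrict β)) →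
    Node.Splits carrier u

/-- Trees are ordered by inclusion; smaller trees are stronger conditions. -/
instance (κ : Cardinal.{u}) : Preorder (SacksTree κ) :=
  Preorder.lift SacksTree.carrier

/-- The `κ`-support product of generalized Sacks forcing with index set `A`: functions `p` from
`A` to Sacks trees such that `{β ∈ A : p β ≠ 2^{<κ}}` has size at most `κ`. -/
structure SacksProduct (κ : Cardinal.{u}) (A : Type u) : Type u where
  tree : A → SacksTree κ
  supp_le : Cardinal.mk {β : A // (tree β).carrier ≠ Set.univ} ≤ κ

/-- The coordinatewise order. -/
instance (κ : Cardinal.{u}) (A : Type u) : Preorder (SacksProduct κ A) :=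
  Preorder.lift SacksProduct.tree

/-! ### Forcing: antichains, names and the forcing relation -/

section Forcing

variable {P : Type u} [Preorder P]

/-- Two conditions are compatible if they have a common extension. -/
def Compatible (p q : P) : Prop := ∃ r, r ≤ p ∧ r ≤ q

/-- An antichain in the sense of forcing: a set of pairwise incompatible conditions. -/
def IsForcingAntichain (S : Set P) : Prop :=
  ∀ a ∈ S, ∀ b ∈ S, a ≠ b → ¬ Compatible a b

/-- A maximal antichain: an antichain that is maximal with respect to inclusion. -/
def IsMaximalAntichain (S : Set P) : Prop :=
  Maximal IsForcingAntichain S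

/-- `S` is predense below `q`: every extension of `q` is compatible with a member of `S`. -/
def PredenseBelow (S : Set P) (q : P) : Prop :=
  ∀ r ≤ q, ∃ b ∈ S, Compatible r b

/-- `P`-names: (small) sets of pairs `(σ, c)`, where `σ` is a `P`-name and `c` is a condition. -/
inductive PName (P : Type u) : Type (u + 1)
  | mk (ι : Type u) (name : ι → PName P) (cond : ι → P) : PName P

/-- `p ⊩ σ = τ`. Writing `σ = {(σᵢ, cᵢ)}` and `τ = {(τⱼ, dⱼ)}`: whenever `q ≤ p` extends `cᵢ`, some
`r ≤ q` extends some `dⱼ` such that `r ⊩ σᵢ = τⱼ` (so that `q ⊩ σᵢ ∈ τ`), and symmetrically. -/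
def ForcesEq : PName P → PName P → P → Prop
  | .mk _ σ c, .mk _ τ d => fun p =>
    (∀ i, ∀ q ≤ p, q ≤ c i → ∃ r ≤ q, ∃ j, r ≤ d j ∧ ForcesEq (σ i) (τ j) r) ∧
    (∀ j, ∀ q ≤ p, q ≤ d j → ∃ r ≤ q, ∃ i, r ≤ c i ∧ ForcesEq (σ i) (τ j) r)

/-- `p ⊩ σ ∈ τ`: densely many `r` below `p` extend some `dⱼ` with `(τⱼ, dⱼ) ∈ τ` and
`r ⊩ σ = τⱼ`. -/
def ForcesMem (σ : PName P) : PName P → P → Prop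
  | .mk _ τ d => fun p => ∀ q ≤ p, ∃ r ≤ q, ∃ j, r ≤ d j ∧ ForcesEq σ (τ j) r

/-- The forcing relation for an implication. Here and below, a statement of the forcing language is
represented by the set of the conditions that force it. -/
def fImp (Φ Ψ : P → Prop) : P → Prop := fun p => ∀ q ≤ p, Φ q → Ψ q

/-- The forcing relation for a conjunction. -/
def fAnd (Φ Ψ : P → Prop) : P → Prop := fun p => Φ p ∧ Ψ p

/-- The forcing relation for a universal quantifier (over all names). -/
def fAll (Φ : PName P → P → Prop) : P → Prop := fun p => ∀ x, Φ x p

/-- The forcing relation for an existential quantifier (over all names). -/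
def fEx (Φ : PName P → P → Prop) : P → Prop := fun p => ∀ q ≤ p, ∃ r ≤ q, ∃ x, Φ x r

/-- The canonical name `x̌ = {(y̌, c) : y ∈ x, c ∈ P}` of a set `x` of the ground model. -/
noncomputable def check (x : ZFSet.{u}) : PName P :=
  .mk (Shrink.{u} x × P) (fun z => check ((equivShrink x).symm z.1).1) (fun z => z.2)
termination_by x
decreasing_by exact ((equivShrink x).symm z.1).2

/-- `p ⊩ y ∈ V`, i.e. `y` is forced to belong to the ground model: densely many `r` below `p` force
`y = ǎ` for some ground model set `a`. -/
def ForcesGround (y : PName P) : P → Prop := fun p =>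
  ∀ q ≤ p, ∃ r ≤ q, ∃ a : ZFSet.{u}, ForcesEq y (check a) r

/-- The canonical name of the unordered pair `{σ, τ}`. -/
def pairName (σ τ : PName P) : PName P :=
  .mk (ULift.{u} Bool × P) (fun z => if z.1.down then σ else τ) (fun z => z.2)

/-- The canonical name of the Kuratowski pair `(σ, τ) = {{σ}, {σ, τ}}`. -/
def opName (σ τ : PName P) : PName P :=
  pairName (pairName σ σ) (pairName σ τ)

/-- `p ⊩ "f is a function with domain D and values in B"`, for a class `B` of the forcing language:
`f` is a set of ordered pairs with first coordinate in `D`, it is single-valued, and for all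
`x ∈ D` there is `y ∈ B` with `(x, y) ∈ f`. -/
def ForcesFunction (f D : PName P) (B : PName P → P → Prop) : P → Prop :=
  fAnd (fAll fun z => fImp (ForcesMem z f)
      (fEx fun x => fEx fun y => fAnd (ForcesMem x D) (ForcesEq z (opName x y))))
    (fAnd
      (fAll fun x => fAll fun y => fAll fun y' =>
        fImp (fAnd (ForcesMem (opName x y) f) (ForcesMem (opName x y') f)) (ForcesEq y y'))
      (fAll fun x => fImp (ForcesMem x D) (fEx fun y => fAnd (B y) (ForcesMem (opName x y) f))))

/-- `p ⊩ f(x) ∈ b`: it is forced that there is `y ∈ b` with `(x, y) ∈ f`. -/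
def ForcesValueMem (f x b : PName P) : P → Prop :=
  fEx fun y => fAnd (ForcesMem y b) (ForcesMem (opName x y) f)

end Forcing

/-! ### Slaloms and the generalized Sacks property -/

/-- `φ` is an `h`-slalom: `φ(α) ∈ [κ]^{|h(α)|}` for all `α < κ`. -/
def IsSlalom (κ : Cardinal.{u}) (h : Ordinal.{u} → Ordinal.{u}) (φ : Ordinal.{u} → ZFSet.{u}) :
    Prop :=
  ∀ α < κ.ord, φ α ⊆ κ.ord.toZFSet ∧ (φ α).card = (h α).card

/-- The generalized `h`-Sacks property of a forcing notion `P`, for a function `h : κ → κ` with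
`lim_{α → κ} h(α) = κ`. -/
structure HasGeneralizedSacksProperty (κ : Cardinal.{u}) (h : Ordinal.{u} → Ordinal.{u})
    (P : Type u) [Preorder P] : Prop where
  lt_ord : ∀ α < κ.ord, h α < κ.ord
  tendsto : ∀ β < κ.ord, ∃ γ < κ.ord, ∀ α < κ.ord, γ ≤ α → β ≤ h α
  localize : ∀ (p : P) (f : PName P),
    ForcesFunction f (check κ.ord.toZFSet) (fun y => ForcesMem y (check κ.ord.toZFSet)) p →
    ∃ q ≤ p, ∃ φ : Ordinal.{u} → ZFSet.{u}, IsSlalom κ h φ ∧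
      ∀ α < κ.ord, ForcesValueMem f (check α.toZFSet) (check (φ α)) q

/-- The power set function `h(α) = 2^{|α|}`. -/
noncomputable def powerFun (α : Ordinal.{u}) : Ordinal.{u} :=
  ((2 : Cardinal.{u}) ^ α.card).ord

end GenSacks

namespace GenSacks

open Cardinal Set

set_option linter.unusedSectionVars false

/-! ### The index set `κ`: regularity and transfinite choice -/

section Index

variable {κ : Cardinal.{u}} [hκ : Fact κ.IsInaccessible]

/-! All three parts come from one fusion statement, `exists_predenseBelow`: if open sets `D α` are
dense below `p`, some `q ≤ p` has for every `α` at most `2 ^ |α|` members of `D α` that are predense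
below it. For (a) and (b), `D α` consists of the conditions deciding `f(α)`; in (a) the set of
values is then padded to the exact size. For (c), `D α` consists of the conditions below a member of
the antichain.

The fusion keeps, at level `α`, conditions `N α x` in `D α`, where `x` assigns a bit to each level
and coordinate. Only coordinates in an active set `F α`, of size at most `|α|·|α|` and empty for
finite `α`, are split there, and `(N α x).tree a` depends only on the bits `x δ a` with `δ ≤ α` and
`a ∈ F δ`. Hence at most `2 ^ |α| < κ` members differ, and `exists_local_refinement` moves them into
`D α` one after another; infima exist at limits by regularity. Since coordinate `a` sees only bits
at `a`, the limit is again a product: in coordinate `a` the stems form a `SplittingScheme`, whose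
initial segments form a Sacks tree. Bookkeeping makes every coordinate that occurs in a support
active eventually.

For predensity, let `r ≤ q`. In each coordinate of `F α`, a long enough node of `r` fixes the bits
up to level `α` (`exists_decided`). Together these bits give an `x` with `r` compatible with `N α x`
(`exists_compatible`). -/

instance : NoMaxOrder κ.ord.ToType :=
  Cardinal.noMaxOrder hκ.out.aleph0_lt.le

theorem exists_forall_lt_of_mk_lt {J : Type u} (hJ : #J < κ) (f : J → κ.ord.ToType) :
    ∃ b, ∀ j, f j < b := by
  by_contra! h
  have hc : IsCofinal (range f) := fun b => by
    obtain ⟨j, hj⟩ := h b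
    exact ⟨f j, mem_range_self j, hj⟩
  have h1 := (Order.cof_le hc).trans mk_range_le
  rw [Ordinal.cof_toType, hκ.out.isRegular.cof_ord] at h1
  exact absurd h1 hJ.not_ge

theorem mk_Iio_lt_of_inaccessible (α : κ.ord.ToType) : #(Iio α) < κ := by
  simpa using mk_Iio_lt α (by simp)

theorem mk_Iic_lt_of_inaccessible (α : κ.ord.ToType) : #(Iic α) < κ := by
  obtain ⟨β, hβ⟩ := exists_gt α
  exact (mk_le_mk_of_subset fun x hx => lt_of_le_of_lt hx hβ).trans_lt
    (mk_Iio_lt_of_inaccessible β)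

/-- Transfinite dependent choice. -/
theorem exists_forall_of_step {ι : Type*} [LinearOrder ι] [WellFoundedLT ι] {β : Type*}
    (Q : ∀ α : ι, (Iio α → β) → β → Prop)
    (h : ∀ (α : ι) (f : Iio α → β),
      (∀ γ : Iio α, Q γ (fun δ => f ⟨δ.1, δ.2.trans γ.2⟩) (f γ)) → ∃ b, Q α f b) :
    ∃ f : ι → β, ∀ α, Q α (fun γ => f γ) (f α) := by
  classical
  by_cases hβ : Nonempty β
  · let step : ∀ α : ι, (∀ γ, γ < α → β) → β := fun α f =>
      if h : ∃ b, Q α (fun γ => f γ.1 γ.2) b then h.choose else Classical.choice hβ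
    let F : ι → β := WellFounded.fix wellFounded_lt step
    have hF : ∀ α, F α = step α fun γ _ => F γ := fun α => WellFounded.fix_eq _ _ _
    refine ⟨F, fun α => ?_⟩
    induction α using WellFoundedLT.induction with
    | ind α ih =>
      have h' : ∃ b, Q α (fun γ => F γ.1) b := h α _ fun γ => ih γ.1 γ.2
      have : F α = h'.choose := by
        rw [hF α]
        exact dif_pos h'
      rw [this]
      exact h'.choose_spec
  -- Without values there can be no indices: at the least index the hypothesis is vacuous, so `h`
  -- would supply a value.
  · by_cases hι : Nonempty ι
    · obtain ⟨α, -, hα⟩ := wellFounded_lt.has_min (univ : Set ι) ⟨Classical.choice hι, trivial⟩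
      have hem : IsEmpty (Iio α) := ⟨fun γ => hα γ.1 trivial γ.2⟩
      obtain ⟨b, -⟩ := h α (fun γ => hem.elim γ) fun γ => hem.elim γ
      exact (hβ ⟨b⟩).elim
    · exact ⟨fun α => (hι ⟨α⟩).elim, fun α => (hι ⟨α⟩).elim⟩

end Index

/-! ### Nodes, initial segments and unions of chains -/

namespace Node

variable {κ : Cardinal.{u}}

theorem ext_of_lt {v w : Node κ} (hl : v.len = w.len) (h : ∀ β < v.len, v.val β = w.val β) :
    v = w := by
  cases v with
  | mk l f hf =>
    cases w with
    | mk l' g hg =>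
      obtain rfl : l = l' := hl
      have : f = g := by
        funext β
        rcases lt_or_ge β l with hb | hb
        · exact h β hb
        · rw [hf β hb, hg β hb]
      subst this
      rfl

theorem IsInit.refl (v : Node κ) : v.IsInit v := ⟨le_rfl, fun _ _ => rfl⟩

theorem IsInit.trans {v w x : Node κ} (h : v.IsInit w) (h' : w.IsInit x) : v.IsInit x :=
  ⟨h.1.trans h'.1, fun β hβ => (h.2 β hβ).trans (h'.2 β (hβ.trans_le h.1))⟩

theorem IsInit.eq_of_le {v w : Node κ} (h : v.IsInit w) (h' : w.len ≤ v.len) : v = w :=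
  ext_of_lt (h.1.antisymm h') h.2

theorem IsInit.of_common {v w x : Node κ} (h : v.IsInit x) (h' : w.IsInit x)
    (hl : v.len ≤ w.len) : v.IsInit w :=
  ⟨hl, fun β hβ => (h.2 β hβ).trans (h'.2 β (hβ.trans_le hl)).symm⟩

theorem restrict_isInit (v : Node κ) (β : κ.ord.ToType) : (v.restrict β).IsInit v :=
  ⟨min_le_right _ _, fun _ hγ => if_pos (hγ.trans_le (min_le_left _ _))⟩

theorem restrict_len {v : Node κ} {β : κ.ord.ToType} (h : β ≤ v.len) :
    (v.restrict β).len = β := min_eq_left h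

theorem IsInit.eq_restrict {v w : Node κ} (h : v.IsInit w) : v = w.restrict v.len :=
  (h.of_common (restrict_isInit w v.len) (restrict_len h.1).ge).eq_of_le (restrict_len h.1).le

variable [hκ : Fact κ.IsInaccessible]

theorem len_lt_snoc_len (v : Node κ) (i : Bool) : v.len < (v.snoc i).len :=
  Order.lt_succ v.len

theorem isInit_snoc (v : Node κ) (i : Bool) : v.IsInit (v.snoc i) :=
  ⟨Order.le_succ _, fun β hβ => by
    simp only [snoc]
    rw [if_pos (hβ.trans (Order.lt_succ _)), if_neg hβ.ne]⟩

theorem snoc_val_len (v : Node κ) (i : Bool) : (v.snoc i).val v.len = i := by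
  simp only [snoc]
  rw [if_pos (Order.lt_succ _), if_pos trivial]

theorem snoc_isInit_iff {v w : Node κ} {i : Bool} :
    (v.snoc i).IsInit w ↔ v.IsInit w ∧ v.len < w.len ∧ w.val v.len = i := by
  constructor
  · intro h
    refine ⟨(isInit_snoc v i).trans h, (len_lt_snoc_len v i).trans_le h.1, ?_⟩
    rw [← h.2 _ (len_lt_snoc_len v i), snoc_val_len]
  · rintro ⟨h, hl, hi⟩
    refine ⟨Order.succ_le_of_lt hl, fun β hβ => ?_⟩
    rcases (Order.lt_succ_iff.1 hβ).lt_or_eq with hb | rfl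
    · rw [← (isInit_snoc v i).2 β hb, h.2 β hb]
    · rw [snoc_val_len, hi]

/-- Incomparable nodes have a least place of disagreement, and `x` is their common restriction to
it. -/
theorem isInit_or_exists_ne (v w : Node κ) : v.IsInit w ∨ w.IsInit v ∨
    ∃ x : Node κ, ∃ i j : Bool, i ≠ j ∧ (x.snoc i).IsInit v ∧ (x.snoc j).IsInit w := by
  by_cases h : ∃ β, β < v.len ∧ β < w.len ∧ v.val β ≠ w.val β
  · obtain ⟨β, ⟨hv, hw, hne⟩, hmin⟩ := wellFounded_lt.has_min
      {β | β < v.len ∧ β < w.len ∧ v.val β ≠ w.val β} h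
    have hl := restrict_len hv.le
    refine .inr (.inr ⟨v.restrict β, v.val β, w.val β, hne, snoc_isInit_iff.2
      ⟨restrict_isInit _ _, hl.trans_lt hv, by rw [hl]⟩, snoc_isInit_iff.2
      ⟨⟨hl.trans_le hw.le, fun γ hγ => ?_⟩, hl.trans_lt hw, by rw [hl]⟩⟩)
    rw [(restrict_isInit v β).2 γ hγ]
    rw [hl] at hγ
    by_contra hc
    exact hmin γ ⟨hγ.trans hv, hγ.trans hw, hc⟩ hγ
  · push Not at h
    rcases le_total v.len w.len with hl | hl
    · exact .inl ⟨hl, fun β hβ => h β hβ (hβ.trans_le hl)⟩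
    · exact .inr (.inl ⟨hl, fun β hβ => (h β (hβ.trans_le hl) hβ).symm⟩)


/-- `t` is the union of the nodes in `N`. -/
def IsUnion (N : Set (Node κ)) (t : Node κ) : Prop :=
  (∀ n ∈ N, n.IsInit t) ∧ ∀ β < t.len, ∃ n ∈ N, β < n.len

/-- The length is the least upper bound of the lengths in `N`, which exists below `κ` thanks to `b`;
the value at `β` is read off any longer member, the choice being irrelevant in a chain. -/
theorem exists_isUnion {N : Set (Node κ)} (hN : ∀ m ∈ N, ∀ n ∈ N, m.IsInit n ∨ n.IsInit m)
    {b : κ.ord.ToType} (hb : ∀ n ∈ N, n.len ≤ b) : ∃ t, IsUnion N t ∧ t.len ≤ b := by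
  classical
  obtain ⟨l, hl, hmin⟩ := wellFounded_lt.has_min
    {l : κ.ord.ToType | ∀ n ∈ N, n.len ≤ l} ⟨b, hb⟩
  have key : ∀ β < l, ∃ n ∈ N, β < n.len := fun β hβ => by
    by_contra! h
    exact hmin β h hβ
  have hd : Nonempty (Node κ) := ⟨⟨b, fun _ => false, fun _ _ => rfl⟩⟩
  choose! g hgN hg using key
  refine ⟨⟨l, fun β => if β < l then (g β).val β else false, fun β hβ => if_neg hβ.not_gt⟩,
    ⟨fun n hn => ⟨hl n hn, fun β hβ => ?_⟩, fun β hβ => ⟨g β, hgN β hβ, hg β hβ⟩⟩,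
    not_lt.1 (hmin b hb)⟩
  have hβl := hβ.trans_le (hl n hn)
  simp only
  rw [if_pos hβl]
  rcases hN n hn _ (hgN β hβl) with h | h
  · exact h.2 β hβ
  · exact (h.2 β (hg β hβl)).symm

end Node

/-! ### Sacks trees: stems, cones, intersections of chains -/

section

variable {κ : Cardinal.{u}} [hκ : Fact κ.IsInaccessible]

theorem Node.exists_root : ∃ r : Node κ, ∀ v, r.IsInit v := by
  have : Nonempty κ.ord.ToType := by
    rw [Ordinal.nonempty_toType_iff]
    simpa using hκ.out.ne_zero
  obtain ⟨o, -, ho⟩ := wellFounded_lt.has_min (univ : Set κ.ord.ToType) univ_nonempty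
  exact ⟨⟨o, fun _ => false, fun _ _ => rfl⟩, fun v => ⟨not_lt.1 (ho _ trivial),
    fun β hβ => (ho β trivial hβ).elim⟩⟩

theorem Node.Splits.mem {S : Set (Node κ)} (hS : ∀ v ∈ S, ∀ w : Node κ, w.IsInit v → w ∈ S)
    {v : Node κ} (h : Node.Splits S v) : v ∈ S :=
  hS _ (h true) _ (Node.isInit_snoc v true)

theorem Node.Splits.mono {S S' : Set (Node κ)} (hS : S ⊆ S')
    {v : Node κ} (h : Node.Splits S v) : Node.Splits S' v := fun i => hS (h i)

namespace SacksTree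

theorem ext_carrier {S T : SacksTree κ} (h : S.carrier = T.carrier) : S = T := by
  cases S
  cases T
  subst h
  rfl

/-- Reduces closure under unions of chains to the limit axioms of a tree: a union that is not
attained has limit length, with the lengths in `N` cofinal in it. -/
theorem isSuccLimit_of_isUnion {N : Set (Node κ)} {t : Node κ} (h : Node.IsUnion N t)
    (hne : N.Nonempty) (ht : t ∉ N) :
    Order.IsSuccLimit t.len ∧ ∀ β < t.len, ∃ n ∈ N, β < n.len ∧ n.len < t.len := by
  have key : ∀ n ∈ N, n.len < t.len := fun n hn => lt_of_not_ge fun hle =>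
    ht ((h.1 n hn).eq_of_le hle ▸ hn)
  have key' : ∀ β < t.len, ∃ n ∈ N, β < n.len ∧ n.len < t.len := fun β hβ => by
    obtain ⟨n, hn, hlt⟩ := h.2 β hβ
    exact ⟨n, hn, hlt, key n hn⟩
  refine ⟨⟨fun hmin => ?_, fun β hβ => ?_⟩, key'⟩
  · obtain ⟨n, hn⟩ := hne
    exact (key n hn).not_ge (hmin (key n hn).le)
  · obtain ⟨n, -, h1, h2⟩ := key' β hβ.lt
    exact hβ.2 h1 h2

theorem mem_of_isUnion (T : SacksTree κ) {N : Set (Node κ)} {t : Node κ} (h : Node.IsUnion N t)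
    (hne : N.Nonempty) (hN : N ⊆ T.carrier) : t ∈ T.carrier := by
  by_cases ht : t ∈ N
  · exact hN ht
  · obtain ⟨hl, hc⟩ := isSuccLimit_of_isUnion h hne ht
    refine T.limit_mem t hl fun β hβ => ?_
    obtain ⟨n, hn, hlt, -⟩ := hc β hβ
    refine T.init_mem n (hN hn) _ ((t.restrict_isInit β).of_common (h.1 n hn) ?_)
    rw [Node.restrict_len hβ.le]
    exact hlt.le

theorem splits_of_isUnion (T : SacksTree κ) {N : Set (Node κ)} {t : Node κ}
    (h : Node.IsUnion N t) (hne : N.Nonempty) (hN : ∀ n ∈ N, Node.Splits T.carrier n) :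
    Node.Splits T.carrier t := by
  by_cases ht : t ∈ N
  · exact hN t ht
  · obtain ⟨hl, hc⟩ := isSuccLimit_of_isUnion h hne ht
    refine T.limit_splits t hl fun β hβ => ?_
    obtain ⟨n, hn, hlt, hlt'⟩ := hc β hβ
    refine ⟨n.len, hlt.le, hlt', ?_⟩
    rw [← (h.1 n hn).eq_restrict]
    exact hN n hn

/-- Every node has a least splitting extension. -/
theorem exists_least_splits (T : SacksTree κ) {v : Node κ} (hv : v ∈ T.carrier) :
    ∃ t ∈ T.carrier, v.IsInit t ∧ Node.Splits T.carrier t ∧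
      (∀ w ∈ T.carrier, v.IsInit w → w.IsInit t ∨ t.IsInit w) ∧
      ∀ w ∈ T.carrier, v.IsInit w → Node.Splits T.carrier w → t.IsInit w := by
  obtain ⟨l, ⟨t, ht, hvt, hs, rfl⟩, hmin⟩ := wellFounded_lt.has_min
    {l | ∃ t ∈ T.carrier, v.IsInit t ∧ Node.Splits T.carrier t ∧ t.len = l} (by
      obtain ⟨t, ht, hvt, hs⟩ := T.exists_splits v hv
      exact ⟨_, t, ht, hvt, hs, rfl⟩)
  have key : ∀ w ∈ T.carrier, v.IsInit w → w.IsInit t ∨ t.IsInit w := by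
    intro w hw hvw
    rcases Node.isInit_or_exists_ne w t with h | h | ⟨x, i, j, hij, hi, hj⟩
    · exact .inl h
    · exact .inr h
    -- If `w` left `t` just after `x`, then `x` would be a splitting extension of `v` shorter than
    -- `t`.
    exfalso
    obtain ⟨hxt, hlt, hj'⟩ := Node.snoc_isInit_iff.1 hj
    obtain ⟨hxw, hlw, hi'⟩ := Node.snoc_isInit_iff.1 hi
    refine hmin x.len ⟨x, T.init_mem _ ht _ hxt, ?_, ?_, rfl⟩ hlt
    · refine hvt.of_common hxt (not_lt.1 fun hc => hij ?_)
      rw [← hi', ← hj', ← hvw.2 _ hc, hvt.2 _ hc]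
    · intro k
      have : k = i ∨ k = j := by revert hij; cases i <;> cases j <;> cases k <;> simp
      rcases this with rfl | rfl
      · exact T.init_mem _ hw _ hi
      · exact T.init_mem _ ht _ hj
  refine ⟨t, ht, hvt, hs, key, fun w hw hvw hsw => ?_⟩
  rcases key w hw hvw with h | h
  · rw [h.eq_of_le (not_lt.1 fun hlt => hmin _ ⟨w, hw, hvw, hsw, rfl⟩ hlt)]
    exact .refl t
  · exact h

theorem exists_stem (T : SacksTree κ) :
    ∃ t ∈ T.carrier, Node.Splits T.carrier t ∧
      (∀ w ∈ T.carrier, w.IsInit t ∨ t.IsInit w) ∧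
      ∀ w ∈ T.carrier, Node.Splits T.carrier w → t.IsInit w := by
  obtain ⟨r, hr⟩ := Node.exists_root (κ := κ)
  obtain ⟨v, hv⟩ := T.nonempty
  obtain ⟨t, ht, -, hs, h1, h2⟩ := T.exists_least_splits (T.init_mem v hv r (hr v))
  exact ⟨t, ht, hs, fun w hw => h1 w hw (hr w), fun w hw => h2 w hw (hr w)⟩

/-- The least splitting node of a Sacks tree. -/
noncomputable def stem (T : SacksTree κ) : Node κ := T.exists_stem.choose

theorem stem_mem (T : SacksTree κ) : T.stem ∈ T.carrier := T.exists_stem.choose_spec.1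

theorem stem_splits (T : SacksTree κ) : Node.Splits T.carrier T.stem :=
  T.exists_stem.choose_spec.2.1

theorem stem_isInit_of_splits (T : SacksTree κ) {w : Node κ} (h : Node.Splits T.carrier w) :
    T.stem.IsInit w :=
  T.exists_stem.choose_spec.2.2.2 w (h.mem T.init_mem) h

/-- A node splitting in a set of nodes comparable with `w` extends `w`. -/
theorem isInit_of_splits_of_comparable {S : Set (Node κ)} {w t : Node κ}
    (hS : ∀ v ∈ S, v.IsInit w ∨ w.IsInit v) (h : Node.Splits S t) : w.IsInit t := by
  by_contra hc
  -- Unless `w` is an initial segment of `t`, both successors of `t` are initial segments of `w`,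
  -- which is absurd.
  have key : ∀ i, (t.snoc i).IsInit w := fun i => by
    rcases hS _ (h i) with h' | h'
    · exact h'
    · rcases h'.1.lt_or_eq with hl | hl
      · exact (hc (h'.of_common (Node.isInit_snoc t i) (Order.lt_succ_iff.1 hl))).elim
      · rw [h'.eq_of_le hl.ge]
        exact .refl _
  have h1 := (Node.snoc_isInit_iff.1 (key true)).2.2
  have h2 := (Node.snoc_isInit_iff.1 (key false)).2.2
  exact absurd (h1.symm.trans h2) (by simp)

/-- The subtree of nodes of `T` comparable with `w ∈ T`. -/
def cone (T : SacksTree κ) (w : Node κ) (hw : w ∈ T.carrier) : SacksTree κ where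
  carrier := {v ∈ T.carrier | v.IsInit w ∨ w.IsInit v}
  nonempty := ⟨w, hw, .inl (.refl w)⟩
  init_mem := by
    rintro v ⟨hv, hvw⟩ x hx
    refine ⟨T.init_mem v hv x hx, ?_⟩
    rcases hvw with h | h
    · exact .inl (hx.trans h)
    · rcases le_total x.len w.len with hl | hl
      · exact .inl (hx.of_common h hl)
      · exact .inr (h.of_common hx hl)
  exists_splits := by
    have key : ∀ v ∈ T.carrier, w.IsInit v → ∃ t ∈ {v ∈ T.carrier | v.IsInit w ∨ w.IsInit v},
        v.IsInit t ∧ Node.Splits {v ∈ T.carrier | v.IsInit w ∨ w.IsInit v} t := by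
      intro v hv hwv
      obtain ⟨t, ht, hvt, hs⟩ := T.exists_splits v hv
      exact ⟨t, ⟨ht, .inr (hwv.trans hvt)⟩, hvt,
        fun i => ⟨hs i, .inr ((hwv.trans hvt).trans (t.isInit_snoc i))⟩⟩
    rintro v ⟨hv, h | h⟩
    · obtain ⟨t, ht, hwt, hs⟩ := key w hw (.refl w)
      exact ⟨t, ht, h.trans hwt, hs⟩
    · exact key v hv h
  limit_mem := by
    intro v hl h
    refine ⟨T.limit_mem v hl fun β hβ => (h β hβ).1, ?_⟩
    by_contra! hc
    rcases Node.isInit_or_exists_ne v w with h' | h' | ⟨x, i, j, hij, hi, hj⟩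
    · exact hc.1 h'
    · exact hc.2 h'
    obtain ⟨hxv, hlv, hi'⟩ := Node.snoc_isInit_iff.1 hi
    obtain ⟨hxw, hlw, hj'⟩ := Node.snoc_isInit_iff.1 hj
    -- As `v` has limit length, its restriction one step past `x` is proper, yet already
    -- incomparable with `w`.
    have hs : Order.succ x.len < v.len := hl.succ_lt hlv
    have hlen := Node.restrict_len hs.le
    have hval : (v.restrict (Order.succ x.len)).val x.len = i := by
      rw [(v.restrict_isInit _).2 _ (by rw [hlen]; exact Order.lt_succ _), hi']
    apply hij
    rw [← hval, ← hj']
    rcases (h _ hs).2 with h' | h'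
    · exact h'.2 _ (by rw [hlen]; exact Order.lt_succ _)
    · exact (h'.2 _ hlw).symm
  limit_splits := by
    intro v hl h
    have hs : Node.Splits T.carrier v := T.limit_splits v hl fun γ hγ => by
      obtain ⟨β, h1, h2, h3⟩ := h γ hγ
      exact ⟨β, h1, h2, fun i => (h3 i).1⟩
    have hne : ∃ γ, γ < v.len := by
      by_contra! hc
      exact hl.1 fun b _ => hc b
    obtain ⟨γ, hγ⟩ := hne
    obtain ⟨β, -, -, h3⟩ := h γ hγ
    have hwv : w.IsInit v :=
      (isInit_of_splits_of_comparable (fun x hx => hx.2) h3).trans (v.restrict_isInit β)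
    exact fun i => ⟨hs i, .inr (hwv.trans (v.isInit_snoc i))⟩

/-- The intersection of a chain of fewer than `κ` Sacks trees is a Sacks tree. -/
theorem exists_carrier_eq_iInter {J : Type u} [Nonempty J] (hJ : #J < κ) (T : J → SacksTree κ)
    (hT : ∀ i j, (T i).carrier ⊆ (T j).carrier ∨ (T j).carrier ⊆ (T i).carrier) :
    ∃ S : SacksTree κ, S.carrier = {v | ∀ j, v ∈ (T j).carrier} := by
  obtain ⟨r, hr⟩ := Node.exists_root (κ := κ)
  refine ⟨⟨{v | ∀ j, v ∈ (T j).carrier}, ⟨r, fun j => ?_⟩,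
    fun v hv w hw j => (T j).init_mem v (hv j) w hw, fun v hv => ?_,
    fun v hl h j => (T j).limit_mem v hl fun β hβ => h β hβ j,
    fun v hl h i j => (T j).limit_splits v hl (fun γ hγ => ?_) i⟩, rfl⟩
  · obtain ⟨v, hv⟩ := (T j).nonempty
    exact (T j).init_mem v hv r (hr v)
  -- Least splitting extensions of `v` lengthen as the trees shrink. Their union `x` exists by
  -- regularity, and it splits in each `T j`, being the union of those `t i` with `T i ⊆ T j`.
  · choose t ht hvt hs _ hmin using fun j => (T j).exists_least_splits (hv j)
    have hmono : ∀ i j, (T i).carrier ⊆ (T j).carrier → (t j).IsInit (t i) := fun i j hij =>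
      hmin j (t i) (hij (ht i)) (hvt i) ((hs i).mono hij)
    obtain ⟨b, hb⟩ := exists_forall_lt_of_mk_lt hJ fun j => (t j).len
    obtain ⟨x, hx, -⟩ := Node.exists_isUnion (N := range t) (b := b) (by
      rintro _ ⟨i, rfl⟩ _ ⟨j, rfl⟩
      rcases hT i j with h | h
      · exact .inr (hmono i j h)
      · exact .inl (hmono j i h)) (by
      rintro _ ⟨i, rfl⟩
      exact (hb i).le)
    have hsx : ∀ j, Node.Splits (T j).carrier x := fun j => by
      refine (T j).splits_of_isUnion (N := t '' {i | (T i).carrier ⊆ (T j).carrier})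
        ⟨?_, fun β hβ => ?_⟩ ⟨t j, j, Subset.rfl, rfl⟩ ?_
      · rintro _ ⟨i, -, rfl⟩
        exact hx.1 _ ⟨i, rfl⟩
      · obtain ⟨_, ⟨i, rfl⟩, hlt⟩ := hx.2 β hβ
        rcases hT i j with h | h
        · exact ⟨t i, ⟨i, h, rfl⟩, hlt⟩
        · exact ⟨t j, ⟨j, Subset.rfl, rfl⟩, hlt.trans_le (hmono j i h).1⟩
      · rintro _ ⟨i, hi, rfl⟩
        exact (hs i).mono hi
    refine ⟨x, fun j => (hsx j).mem (T j).init_mem, ?_, fun i j => hsx j i⟩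
    obtain ⟨j⟩ := ‹Nonempty J›
    exact (hvt j).trans (hx.1 _ ⟨j, rfl⟩)
  · obtain ⟨β, h1, h2, h3⟩ := h γ hγ
    exact ⟨β, h1, h2, fun i => h3 i j⟩

/-- With lengths bounded by `l`, chains above `v` would have unions in `T`, and Zorn's lemma would
give a maximal node, contradicting `exists_splits`. -/
theorem exists_lt_len (T : SacksTree κ) {v : Node κ} (hv : v ∈ T.carrier) (l : κ.ord.ToType) :
    ∃ w ∈ T.carrier, v.IsInit w ∧ l < w.len := by
  by_contra! hc
  obtain ⟨m, hm⟩ := exists_maximal_of_chains_bounded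
    (α := {w : Node κ // w ∈ T.carrier ∧ v.IsInit w}) (r := fun w w' => w.1.IsInit w'.1)
    (fun c hch => by
      rcases c.eq_empty_or_nonempty with rfl | hne
      · exact ⟨⟨v, hv, .refl v⟩, by simp⟩
      obtain ⟨t, ht, -⟩ := Node.exists_isUnion (N := Subtype.val '' c) (b := l) (by
        rintro _ ⟨x, hx, rfl⟩ _ ⟨y, hy, rfl⟩
        by_cases hxy : x = y
        · rw [hxy]
          exact .inl (.refl _)
        · exact hch hx hy hxy) (by
        rintro _ ⟨x, -, rfl⟩
        exact hc _ x.2.1 x.2.2)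
      have hxt : ∀ x ∈ c, x.1.IsInit t := fun x hx => ht.1 _ ⟨x, hx, rfl⟩
      have htT := T.mem_of_isUnion ht (hne.image _) (by
        rintro _ ⟨x, -, rfl⟩
        exact x.2.1)
      obtain ⟨x, hx⟩ := hne
      exact ⟨⟨t, htT, x.2.2.trans (hxt x hx)⟩, hxt⟩)
    (fun h h' => h.trans h')
  obtain ⟨t, ht, hmt, hs⟩ := T.exists_splits m.1 m.2.1
  have h1 := (hm ⟨t.snoc true, hs true, (m.2.2.trans hmt).trans (t.isInit_snoc _)⟩
    (hmt.trans (t.isInit_snoc _))).1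
  exact (h1.trans hmt.1).not_gt (t.len_lt_snoc_len true)

end SacksTree

end

/-! ### Splitting schemes and the trees they generate -/

section

variable {κ : Cardinal.{u}} [hκ : Fact κ.IsInaccessible]

/-- A continuous system of splitting nodes `s α y`, indexed by the levels `α ∈ C` and by the
branches `y`. -/
structure SplittingScheme (κ : Cardinal.{u}) where
  C : Set κ.ord.ToType
  s : κ.ord.ToType → (κ.ord.ToType → Bool) → Node κ
  unbounded : ∀ b, ∃ α ∈ C, b < α
  congr : ∀ α ∈ C, ∀ y z, (∀ β ∈ C, β < α → y β = z β) → s α y = s α z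
  snoc_isInit : ∀ α ∈ C, ∀ β ∈ C, α < β → ∀ y, ((s α y).snoc (y α)).IsInit (s β y)
  union : ∀ α ∈ C, (∃ β ∈ C, β < α) → (∀ β ∈ C, β < α → ∃ γ ∈ C, β < γ ∧ γ < α) →
    ∀ y, ∀ ξ < (s α y).len, ∃ δ ∈ C, δ < α ∧ ξ < (s δ y).len

namespace SplittingScheme

variable (S : SplittingScheme κ)

/-- The set of all initial segments of nodes of a splitting scheme. -/
def carrier : Set (Node κ) := {v | ∃ α ∈ S.C, ∃ y, v.IsInit (S.s α y)}

theorem init_mem : ∀ v ∈ S.carrier, ∀ w : Node κ, w.IsInit v → w ∈ S.carrier :=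
  fun _ ⟨α, hα, y, h⟩ _ hw => ⟨α, hα, y, hw.trans h⟩

variable {S}

theorem len_lt {α β : κ.ord.ToType} (hα : α ∈ S.C) (hβ : β ∈ S.C) (h : α < β)
    (y : κ.ord.ToType → Bool) : (S.s α y).len < (S.s β y).len :=
  (Node.snoc_isInit_iff.1 (S.snoc_isInit α hα β hβ h y)).2.1

theorem isInit_of_le {α β : κ.ord.ToType} (hα : α ∈ S.C) (hβ : β ∈ S.C) (h : α ≤ β)
    (y : κ.ord.ToType → Bool) : (S.s α y).IsInit (S.s β y) := by
  rcases h.lt_or_eq with h | rfl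
  · exact (Node.isInit_snoc _ _).trans (S.snoc_isInit α hα β hβ h y)
  · exact .refl _

/-- Lengths increase strictly along `C`, so a bound `l` would inject `C` into an initial segment,
and by regularity `C` would be bounded. -/
theorem exists_len_gt (y : κ.ord.ToType → Bool) (l : κ.ord.ToType) :
    ∃ α ∈ S.C, l < (S.s α y).len := by
  classical
  by_contra! hc
  have hinj : ∀ α ∈ S.C, ∀ β ∈ S.C, (S.s α y).len = (S.s β y).len → α = β := by
    intro α hα β hβ h
    rcases lt_trichotomy α β with h' | h' | h'
    · exact absurd h (len_lt hα hβ h' y).ne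
    · exact h'
    · exact absurd h (len_lt hβ hα h' y).ne'
  obtain ⟨b, hb⟩ := exists_forall_lt_of_mk_lt (mk_Iic_lt_of_inaccessible l)
    fun ξ => if h : ∃ α ∈ S.C, (S.s α y).len = ξ then h.choose else l
  obtain ⟨α, hα, hbα⟩ := S.unbounded b
  have h := hb ⟨(S.s α y).len, hc α hα⟩
  have hex : ∃ β ∈ S.C, (S.s β y).len = (S.s α y).len := ⟨α, hα, rfl⟩
  rw [dif_pos hex, hinj _ hex.choose_spec.1 α hα hex.choose_spec.2] at h
  exact h.not_gt hbα

/-- A node records the bits of the branch it follows: by induction, agreement below `δ` gives `s δ y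
= s δ z`, and the bit of `v` after this node is both `y δ` and `z δ`. -/
theorem agree {v : Node κ} {y z : κ.ord.ToType → Bool} {γ α : κ.ord.ToType} (hγ : γ ∈ S.C)
    (hv : v.IsInit (S.s γ z))
    (h : ∀ δ ∈ S.C, δ < α → ((S.s δ y).snoc (y δ)).IsInit v) :
    ∀ δ ∈ S.C, δ < α → δ < γ ∧ y δ = z δ := by
  intro δ
  induction δ using WellFoundedLT.induction with
  | ind δ ih =>
    intro hδ hδα
    have hag : ∀ ε ∈ S.C, ε < δ → y ε = z ε := fun ε hε hlt => (ih ε hlt hε (hlt.trans hδα)).2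
    have hδγ : δ < γ := by
      by_contra! hle
      have h1 : S.s γ y = S.s γ z := S.congr γ hγ y z fun ε hε hlt => hag ε hε (hlt.trans_le hle)
      have h2 := ((h γ hγ (hle.trans_lt hδα)).trans hv).1
      rw [h1] at h2
      exact h2.not_gt (Node.len_lt_snoc_len _ _)
    refine ⟨hδγ, ?_⟩
    have h1 := (Node.snoc_isInit_iff.1 ((h δ hδ hδα).trans hv)).2.2
    have h2 := (Node.snoc_isInit_iff.1 (S.snoc_isInit δ hδ γ hγ hδγ z)).2.2
    rw [S.congr δ hδ y z hag] at h1
    exact h1.symm.trans h2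

theorem splits (α : κ.ord.ToType) (hα : α ∈ S.C) (y : κ.ord.ToType → Bool) :
    Node.Splits S.carrier (S.s α y) := by
  classical
  intro i
  obtain ⟨β, hβ, hlt⟩ := S.unbounded α
  refine ⟨β, hβ, Function.update y α i, ?_⟩
  have h := S.snoc_isInit α hα β hβ hlt (Function.update y α i)
  rwa [Function.update_self, S.congr α hα (Function.update y α i) y fun γ _ hγ =>
    Function.update_of_ne hγ.ne _ _] at h

/-- Reads off the branch that `v` follows. The recursion makes sense because `s α y` depends only on
the bits before `α`. -/
theorem exists_branch (v : Node κ) : ∃ y : κ.ord.ToType → Bool,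
    ∀ α ∈ S.C, (S.s α y).IsInit v → (S.s α y).len < v.len → y α = v.val (S.s α y).len := by
  classical
  obtain ⟨y, hy⟩ := exists_forall_of_step (ι := κ.ord.ToType)
    (fun α f b => b = v.val (S.s α fun β => if h : β < α then f ⟨β, h⟩ else false).len)
    fun _ _ _ => ⟨_, rfl⟩
  refine ⟨y, fun α hα _ _ => ?_⟩
  have h := hy α
  simp only at h
  rw [h]
  congr 2
  refine S.congr α hα _ _ fun β _ hlt => ?_
  rw [dif_pos hlt]

/-- Every `s γ y` on the branch `y` read off `v` is comparable with `v`, and a long one extends it.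
If `s γ y` left `v` after `x`, the part of `v` one step past `x` would lie in some `s η z`; by
`agree`, `z` follows `y` below `γ`, so `s γ z = s γ y`, a contradiction. -/
theorem mem_of_forall_restrict {v : Node κ} (hl : Order.IsSuccLimit v.len)
    (h : ∀ β < v.len, v.restrict β ∈ S.carrier) : v ∈ S.carrier := by
  obtain ⟨y, hy⟩ := exists_branch (S := S) v
  have key : ∀ γ ∈ S.C, (S.s γ y).IsInit v ∨ v.IsInit (S.s γ y) := by
    intro γ
    induction γ using WellFoundedLT.induction with
    | ind γ ih =>
      intro hγ
      rcases Node.isInit_or_exists_ne (S.s γ y) v with h' | h' | ⟨x, i, j, hij, hi, hj⟩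
      · exact .inl h'
      · exact .inr h'
      exfalso
      have hxs := (Node.snoc_isInit_iff.1 hi)
      have hxv := (Node.snoc_isInit_iff.1 hj)
      have hxl : Order.succ x.len < v.len := hl.succ_lt hxv.2.1
      obtain ⟨η, hη, z, hz⟩ := h _ hxl
      rw [show v.restrict (Order.succ x.len) = x.snoc j from hj.eq_restrict.symm] at hz
      have hne : ∀ w : Node κ, (x.snoc i).IsInit w → ¬ (x.snoc j).IsInit w := fun w h1 h2 =>
        hij ((Node.snoc_isInit_iff.1 h1).2.2.symm.trans (Node.snoc_isInit_iff.1 h2).2.2)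
      have hle : ∀ δ ∈ S.C, δ < γ → ((S.s δ y).snoc (y δ)).IsInit (x.snoc j) := by
        intro δ hδ hδγ
        have hsub := isInit_of_le hδ hγ hδγ.le y
        have hsv : (S.s δ y).IsInit v := by
          rcases ih δ hδγ hδ with h' | h'
          · exact h'
          · exact (hne _ hi (hj.trans (h'.trans hsub))).elim
        have hlen : (S.s δ y).len ≤ x.len := by
          by_contra! hlt
          have h1 := hsub.2 _ hlt
          have h2 := hsv.2 _ hlt
          exact hij (hxs.2.2.symm.trans (h1.symm.trans (h2.trans hxv.2.2)))
        refine Node.IsInit.of_common (x := v) ?_ hj (Order.succ_le_succ hlen)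
        have hlt := hlen.trans_lt hxv.2.1
        exact Node.snoc_isInit_iff.2 ⟨hsv, hlt, (hy δ hδ hsv hlt).symm⟩
      have hag := agree hη hz hle
      rcases le_or_gt γ η with hγη | hηγ
      · have h1 := S.congr γ hγ y z fun δ hδ hlt => (hag δ hδ hlt).2
        have h2 := isInit_of_le hγ hη hγη z
        rw [← h1] at h2
        exact hne _ (hi.trans h2) hz
      · exact (hag η hη hηγ).1.false
  obtain ⟨γ, hγ, hlt⟩ := exists_len_gt (S := S) y v.len
  rcases key γ hγ with h' | h'
  · exact (h'.1.not_gt hlt).elim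
  · exact ⟨γ, hγ, y, h'⟩

/-- Take the least `γ` with `v` below `s γ y`. If `v` were shorter than `s γ y`, its splitting
restrictions would make the nodes `s δ y`, `δ < γ`, cofinal in `v`, so `γ` would be a limit of `C`;
the continuity field `union` then yields some `s δ y` longer than `v`. -/
theorem splits_of_limit {v : Node κ} (hl : Order.IsSuccLimit v.len)
    (h : ∀ γ < v.len, ∃ β, γ ≤ β ∧ β < v.len ∧ Node.Splits S.carrier (v.restrict β)) :
    Node.Splits S.carrier v := by
  have hv : v ∈ S.carrier := mem_of_forall_restrict hl fun β hβ => by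
    obtain ⟨γ, hβγ, hγ, hs⟩ := h β hβ
    refine S.init_mem _ (hs.mem S.init_mem) _ ((v.restrict_isInit β).of_common
      (v.restrict_isInit γ) ?_)
    rwa [Node.restrict_len hβ.le, Node.restrict_len hγ.le]
  obtain ⟨γ₀, hγ₀, y, hv₀⟩ := hv
  obtain ⟨γ, ⟨hγ, hvγ⟩, hmin⟩ := wellFounded_lt.has_min
    {γ | γ ∈ S.C ∧ v.IsInit (S.s γ y)} ⟨γ₀, hγ₀, hv₀⟩
  rcases hvγ.1.lt_or_eq with hlt | heq
  swap
  · rw [hvγ.eq_of_le heq.ge]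
    exact splits γ hγ y
  exfalso
  have hshort : ∀ δ ∈ S.C, δ < γ → (S.s δ y).len < v.len := fun δ hδ hδγ => by
    by_contra! hle
    exact hmin δ ⟨hδ, hvγ.of_common (isInit_of_le hδ hγ hδγ.le y) hle⟩ hδγ
  have key : ∀ β < v.len, Node.Splits S.carrier (v.restrict β) →
      ∃ δ ∈ S.C, δ < γ ∧ β ≤ (S.s δ y).len := by
    intro β hβ hs
    by_contra! hc
    have hlen := Node.restrict_len hβ.le
    obtain ⟨η, hη, z, hz⟩ := hs (!v.val β)
    have hle : ∀ δ ∈ S.C, δ < γ →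
        ((S.s δ y).snoc (y δ)).IsInit ((v.restrict β).snoc (!v.val β)) := by
      intro δ hδ hδγ
      refine Node.IsInit.trans ?_ (Node.isInit_snoc _ _)
      refine (S.snoc_isInit δ hδ γ hγ hδγ y).of_common ((v.restrict_isInit β).trans hvγ) ?_
      rw [hlen]
      exact Order.succ_le_of_lt (hc δ hδ hδγ)
    have hag := agree hη hz hle
    rcases le_or_gt γ η with hγη | hηγ
    · have h1 := S.congr γ hγ y z fun δ hδ hlt => (hag δ hδ hlt).2
      have h2 := isInit_of_le hγ hη hγη z
      rw [← h1] at h2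
      have h3 := (hvγ.trans h2).2 β hβ
      have h4 := (Node.snoc_isInit_iff.1 hz).2.2
      rw [hlen, ← h3] at h4
      cases hb : v.val β <;> simp [hb] at h4
    · exact (hag η hη hηγ).1.false
  have hex : ∃ β, β < v.len := by
    by_contra! hc
    exact hl.1 fun b _ => hc b
  have key' : ∀ ξ < v.len, ∃ δ ∈ S.C, δ < γ ∧ ξ ≤ (S.s δ y).len := fun ξ hξ => by
    obtain ⟨β, h1, h2, h3⟩ := h ξ hξ
    obtain ⟨δ, hδ, hδγ, hβ⟩ := key β h2 h3
    exact ⟨δ, hδ, hδγ, h1.trans hβ⟩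
  obtain ⟨δ, hδ, hδγ, hlt'⟩ := S.union γ hγ
    (by
      obtain ⟨β, hβ⟩ := hex
      obtain ⟨δ, hδ, hδγ, -⟩ := key' β hβ
      exact ⟨δ, hδ, hδγ⟩)
    (fun β hβ hβγ => by
      obtain ⟨δ, hδ, hδγ, hle⟩ := key' _ (hl.succ_lt (hshort β hβ hβγ))
      refine ⟨δ, hδ, lt_of_not_ge fun hle' => ?_, hδγ⟩
      exact ((isInit_of_le hδ hβ hle' y).1.trans_lt (Order.lt_succ _)).not_ge hle)
    y _ hlt
  exact hlt'.not_gt (hshort δ hδ hδγ)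

variable (S)

/-- The Sacks tree generated by a splitting scheme. -/
def toTree : SacksTree κ where
  carrier := S.carrier
  nonempty := by
    obtain ⟨α, hα, -⟩ := exists_len_gt (S := S) (fun _ => false)
      Node.exists_root.choose.len
    exact ⟨S.s α fun _ => false, α, hα, _, .refl _⟩
  init_mem := S.init_mem
  exists_splits := fun v ⟨α, hα, y, h⟩ => ⟨S.s α y, ⟨α, hα, y, .refl _⟩, h, splits α hα y⟩
  limit_mem := fun _ => mem_of_forall_restrict
  limit_splits := fun _ => splits_of_limit

end SplittingScheme

end

/-! ### Products, infima and local families -/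

section

variable {κ : Cardinal.{u}} [hκ : Fact κ.IsInaccessible] {A : Type u}

theorem mk_iUnion_le_of_forall_le {ι B : Type u} (hι : #ι ≤ κ) (s : ι → Set B)
    (hs : ∀ i, #(s i) ≤ κ) : #(⋃ i, s i) ≤ κ :=
  calc #(⋃ i, s i) ≤ #ι * ⨆ i, #(s i) := mk_iUnion_le _
    _ ≤ κ * κ := mul_le_mul' hι (ciSup_le' hs)
    _ = κ := mul_eq_self hκ.out.aleph0_lt.le

namespace SacksProduct

theorem ext_tree {p q : SacksProduct κ A} (h : ∀ a, p.tree a = q.tree a) : p = q := by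
  cases p
  cases q
  obtain rfl := funext h
  rfl

/-- The support of a condition. -/
def supp (p : SacksProduct κ A) : Set A := {a | (p.tree a).carrier ≠ Set.univ}

theorem mk_supp_le (p : SacksProduct κ A) : #p.supp ≤ κ := p.supp_le

/-- A descending family of fewer than `κ` conditions has an infimum, computed coordinatewise. -/
theorem exists_inf {J : Type u} [LinearOrder J] (hJ : #J < κ) (g : SacksProduct κ A)
    (f : J → SacksProduct κ A) (hg : ∀ j, f j ≤ g) (hf : ∀ i j, i ≤ j → f j ≤ f i) :
    ∃ r : SacksProduct κ A, ∀ a, (r.tree a).carrier =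
      {v | v ∈ (g.tree a).carrier ∧ ∀ j, v ∈ ((f j).tree a).carrier} := by
  -- Adjoining `g` keeps the chain nonempty when `J` is empty.
  let T : Option J → SacksProduct κ A := fun o => o.elim g f
  have hJ' : #(Option J) < κ := by
    rw [mk_option]
    exact add_lt_of_lt hκ.out.aleph0_lt.le hJ (one_lt_aleph0.trans hκ.out.aleph0_lt)
  have hT : ∀ i j, T i ≤ T j ∨ T j ≤ T i := by
    rintro (_ | i) (_ | j)
    · exact .inl le_rfl
    · exact .inr (hg j)
    · exact .inl (hg i)
    · rcases le_total i j with h | h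
      · exact .inr (hf i j h)
      · exact .inl (hf j i h)
  choose S hS using fun a => SacksTree.exists_carrier_eq_iInter hJ' (fun o => (T o).tree a)
    fun i j => (hT i j).imp (fun h => h a) fun h => h a
  refine ⟨⟨S, ?_⟩, fun a => ?_⟩
  · refine (mk_le_mk_of_subset (t := ⋃ o, (T o).supp) fun a ha => ?_).trans
      (mk_iUnion_le_of_forall_le hJ'.le _ fun o => (T o).mk_supp_le)
    by_contra hc
    apply ha
    rw [hS]
    refine eq_univ_of_forall fun v o => ?_
    have : ((T o).tree a).carrier = Set.univ := by
      by_contra h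
      exact hc (mem_iUnion.2 ⟨o, h⟩)
    rw [this]
    trivial
  · change (S a).carrier = _
    rw [hS]
    ext v
    exact ⟨fun h => ⟨h none, fun j => h (some j)⟩, fun h o => by
      cases o with
      | none => exact h.1
      | some j => exact h.2 j⟩

section Local

variable {X : Type u} (rel : A → X → X → Prop)

/-- A family of conditions is local if its `a`-th coordinate at `x` only depends on `x` up to the
relation `rel a`. -/
def IsLocal (g : X → SacksProduct κ A) : Prop :=
  ∀ a x y, rel a x y → (g x).tree a = (g y).tree a

variable {rel}

theorem exists_inf_local {J : Type u} [LinearOrder J] (hJ : #J < κ) {g : X → SacksProduct κ A}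
    {f : J → X → SacksProduct κ A} (hg : ∀ j x, f j x ≤ g x)
    (hf : ∀ i j x, i ≤ j → f j x ≤ f i x) (hgl : IsLocal rel g) (hfl : ∀ j, IsLocal rel (f j)) :
    ∃ r : X → SacksProduct κ A, IsLocal rel r ∧ ∀ x a, ((r x).tree a).carrier =
      {v | v ∈ ((g x).tree a).carrier ∧ ∀ j, v ∈ ((f j x).tree a).carrier} := by
  choose r hr using fun x => exists_inf hJ (g x) (fun j => f j x) (fun j => hg j x)
    fun i j h => hf i j x h
  refine ⟨r, fun a x y h => SacksTree.ext_carrier ?_, hr⟩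
  rw [hr, hr, hgl a x y h]
  ext v
  simp only [fun j => hfl j a x y h]

/-- A local family with fewer than `κ` essentially different members can be refined to a local
family inside a dense open set. -/
theorem exists_local_refinement (hrel : ∀ a, Equivalence (rel a)) {J : Type u} [LinearOrder J]
    [WellFoundedLT J] (hJ : #J < κ) (rep : J → X) (hrep : ∀ x, ∃ j, ∀ a, rel a x (rep j))
    {g : X → SacksProduct κ A} (hg : IsLocal rel g) {D : Set (SacksProduct κ A)}
    (hD : ∀ r ∈ D, ∀ s ≤ r, s ∈ D) (hdense : ∀ x, ∀ r ≤ g x, ∃ s ≤ r, s ∈ D) :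
    ∃ g' : X → SacksProduct κ A, IsLocal rel g' ∧ (∀ x, g' x ≤ g x) ∧ ∀ x, g' x ∈ D := by
  classical
  have hsub : ∀ j : J, #(Iio j) < κ := fun j => (mk_set_le _).trans_lt hJ
  -- Stage `j` strengthens the infimum of the earlier stages at `rep j` into `D`, and copies the new
  -- tree in coordinate `a` to every `x` with `rel a x (rep j)`; this keeps the family local.
  obtain ⟨f, hf⟩ := exists_forall_of_step (ι := J) (β := X → SacksProduct κ A)
    (fun j f b => IsLocal rel b ∧ (∀ x, b x ≤ g x) ∧ (∀ i x, b x ≤ f i x) ∧ b (rep j) ∈ D) (by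
    intro j f ih
    obtain ⟨r, hrl, hr⟩ := exists_inf_local (hsub j) (fun i x => (ih i).2.1 x)
      (fun i i' x h => by
        rcases h.lt_or_eq with h | rfl
        · exact (ih i').2.2.1 ⟨i, h⟩ x
        · exact le_rfl) hg fun i => (ih i).1
    have hrg : ∀ x, r x ≤ g x := fun x a v hv => by
      rw [hr] at hv
      exact hv.1
    obtain ⟨s, hs, hsD⟩ := hdense (rep j) (r (rep j)) (hrg _)
    have hle : ∀ x a, rel a x (rep j) → (s.tree a).carrier ⊆ ((r x).tree a).carrier :=
      fun x a h => by
        rw [hrl a _ _ h]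
        exact hs a
    let b : X → SacksProduct κ A := fun x =>
      ⟨fun a => if rel a x (rep j) then s.tree a else (r x).tree a, by
        refine (mk_le_mk_of_subset (t := s.supp ∪ (r x).supp) fun a ha => ?_).trans
          ((mk_union_le _ _).trans ((add_le_add s.mk_supp_le (r x).mk_supp_le).trans
            (add_eq_self hκ.out.aleph0_lt.le).le))
        by_cases h : rel a x (rep j)
        · exact .inl fun h' => ha (by rwa [if_pos h])
        · exact .inr fun h' => ha (by rwa [if_neg h])⟩
    have hb : ∀ x a, (b x).tree a = if rel a x (rep j) then s.tree a else (r x).tree a :=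
      fun _ _ => rfl
    have hbr : ∀ x, b x ≤ r x := fun x a => by
      change ((b x).tree a).carrier ⊆ _
      rw [hb]
      split_ifs with h
      · exact hle x a h
      · exact Subset.rfl
    refine ⟨b, fun a x y h => ?_, fun x => (hbr x).trans (hrg x),
      fun i x => (hbr x).trans fun a v hv => ?_, ?_⟩
    · rw [hb, hb, hrl a x y h]
      have : rel a x (rep j) ↔ rel a y (rep j) :=
        ⟨fun h' => (hrel a).trans ((hrel a).symm h) h', fun h' => (hrel a).trans h h'⟩
      simp only [this]
    · rw [hr] at hv
      exact hv.2 i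
    · have : b (rep j) = s := ext_tree fun a => by rw [hb, if_pos ((hrel a).refl _)]
      rw [this]
      exact hsD)
  obtain ⟨g', hgl, hg'⟩ := exists_inf_local hJ (fun j x => (hf j).2.1 x)
    (fun i j x h => by
      rcases h.lt_or_eq with h | rfl
      · exact (hf j).2.2.1 ⟨i, h⟩ x
      · exact le_rfl) hg fun j => (hf j).1
  refine ⟨g', hgl, fun x a v hv => ?_, fun x => ?_⟩
  · rw [hg'] at hv
    exact hv.1
  · obtain ⟨j, hj⟩ := hrep x
    have : g' x = g' (rep j) := ext_tree fun a => hgl a _ _ (hj a)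
    rw [this]
    refine hD _ (hf j).2.2.2 _ fun a v hv => ?_
    rw [hg'] at hv
    exact hv.2 j

end Local

end SacksProduct

/-- Bookkeeping for supports. Values are sets with at most one element, so no default coordinate is
needed. -/
theorem exists_enumeration (κ : Cardinal.{u}) (A : Type u) :
    ∃ e : Set A → κ.ord.ToType → Set A, (∀ U γ, (e U γ).Subsingleton) ∧
      ∀ U : Set A, #U ≤ κ → ∀ a ∈ U, ∃ γ, a ∈ e U γ := by
  have key : ∀ U : Set A, ∃ e : κ.ord.ToType → Set A, (∀ γ, (e γ).Subsingleton) ∧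
      (#U ≤ κ → ∀ a ∈ U, ∃ γ, a ∈ e γ) := fun U => by
    by_cases hU : #U ≤ κ
    · have h : #U ≤ #κ.ord.ToType := by simpa using hU
      obtain ⟨g⟩ := h
      refine ⟨fun γ => {a | ∃ h : a ∈ U, g ⟨a, h⟩ = γ}, fun γ a ha b hb => ?_,
        fun _ a ha => ⟨_, ha, rfl⟩⟩
      obtain ⟨ha, rfl⟩ := ha
      obtain ⟨hb, h⟩ := hb
      exact congrArg Subtype.val (g.injective h).symm
    · exact ⟨fun _ => ∅, fun _ => subsingleton_empty, fun h => (hU h).elim⟩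
  choose e he he' using key
  exact ⟨e, he, he'⟩

/-- The branches supported below the level `α` and on the coordinates in `F`. -/
def supportedBranches (α : κ.ord.ToType) (F : Set A) : Set (κ.ord.ToType → A → Bool) :=
  {x | ∀ δ a, x δ a = true → δ ≤ α ∧ a ∈ F}

/-- For infinite `α`, neither the extra level `α` nor the factor `|α|·|α|` enlarges the exponent.
For finite `α` the bound relies on `F = ∅`. -/
theorem mk_supportedBranches_le (α : κ.ord.ToType) (F : Set A)
    (hF : #F ≤ #(Iio α) * #(Iio α)) (hF' : Finite (Iio α) → F = ∅) :
    #(supportedBranches α F) ≤ 2 ^ #(Iio α) := by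
  have h1 : #(supportedBranches α F) ≤ 2 ^ (#(Iic α) * #F) := by
    rw [mul_def, ← mk_set]
    refine mk_le_of_injective (f := fun x => {q : Iic α × F | x.1 q.1 q.2 = true})
      fun x y h => Subtype.ext (funext fun δ => funext fun a => ?_)
    by_cases hδ : δ ≤ α ∧ a ∈ F
    · have := Set.ext_iff.1 h (⟨δ, hδ.1⟩, ⟨a, hδ.2⟩)
      simp only [mem_ofPred_eq] at this
      exact Bool.eq_iff_iff.2 this
    · have hx : x.1 δ a = false := by
        by_contra hc
        exact hδ (x.2 δ a (by simpa using hc))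
      have hy : y.1 δ a = false := by
        by_contra hc
        exact hδ (y.2 δ a (by simpa using hc))
      rw [hx, hy]
  refine h1.trans (power_le_power_left two_ne_zero ?_)
  rcases finite_or_infinite (Iio α) with h | h
  · rw [hF' h]
    simp
  · have hinf : ℵ₀ ≤ #(Iio α) := infinite_iff.1 h
    have hIic : #(Iic α) ≤ #(Iio α) := by
      rw [← Iio_insert]
      exact mk_insert_le.trans (add_one_eq hinf).le
    calc #(Iic α) * #F ≤ #(Iio α) * (#(Iio α) * #(Iio α)) := mul_le_mul' hIic hF
      _ = #(Iio α) := by rw [mul_eq_self hinf, mul_eq_self hinf]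

theorem mk_supportedBranches_lt (α : κ.ord.ToType) (F : Set A)
    (hF : #F ≤ #(Iio α) * #(Iio α)) (hF' : Finite (Iio α) → F = ∅) :
    #(supportedBranches α F) < κ :=
  (mk_supportedBranches_le α F hF hF').trans_lt
    (hκ.out.isStrongLimit.isStrongPrelimit (mk_Iio_lt_of_inaccessible α))

theorem exists_supportedBranch (α : κ.ord.ToType) (F : Set A) (x : κ.ord.ToType → A → Bool) :
    ∃ y ∈ supportedBranches α F, ∀ δ a, δ ≤ α → a ∈ F → x δ a = y δ a := by
  classical
  refine ⟨fun δ a => if δ ≤ α ∧ a ∈ F then x δ a else false, fun δ a h => ?_,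
    fun δ a h h' => (if_pos ⟨h, h'⟩).symm⟩
  by_contra hc
  simp [if_neg hc] at h

end

/-! ### Construction of the fusion sequence -/

section

variable {κ : Cardinal.{u}} [hκ : Fact κ.IsInaccessible] {A : Type u}

/-- Each condition of the family can be cut to the cone of one of the two successors of its stem,
in each coordinate in `F`. -/
theorem SacksProduct.exists_cut {X : Type u} {rel : A → X → X → Prop} {r : X → SacksProduct κ A}
    (hr : SacksProduct.IsLocal rel r) {F : Set A} (hF : #F ≤ κ) (i : X → A → Bool)
    (hi : ∀ a ∈ F, ∀ x y, rel a x y → i x a = i y a) :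
    ∃ g : X → SacksProduct κ A, SacksProduct.IsLocal rel g ∧ (∀ x, g x ≤ r x) ∧
      ∀ a ∈ F, ∀ x, ∀ v ∈ ((g x).tree a).carrier,
        v.IsInit (((r x).tree a).stem.snoc (i x a)) ∨
          (((r x).tree a).stem.snoc (i x a)).IsInit v := by
  classical
  let t : X → A → SacksTree κ := fun x a => if a ∈ F then
    ((r x).tree a).cone (((r x).tree a).stem.snoc (i x a)) (((r x).tree a).stem_splits _)
    else (r x).tree a
  have ht : ∀ x, ∀ a ∈ F, (t x a).carrier = {v ∈ ((r x).tree a).carrier |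
      v.IsInit (((r x).tree a).stem.snoc (i x a)) ∨
        (((r x).tree a).stem.snoc (i x a)).IsInit v} := fun x a ha => by
    simp only [t, if_pos ha]
    rfl
  have ht' : ∀ x, ∀ a ∉ F, t x a = (r x).tree a := fun x a ha => if_neg ha
  refine ⟨fun x => ⟨t x, ?_⟩, fun a x y h => ?_, fun x a => ?_, fun a ha x v hv => ?_⟩
  · refine (mk_le_mk_of_subset (t := F ∪ (r x).supp) fun a ha => ?_).trans
      ((mk_union_le _ _).trans ((add_le_add hF (r x).mk_supp_le).trans
        (add_eq_self hκ.out.aleph0_lt.le).le))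
    by_cases h : a ∈ F
    · exact .inl h
    · exact .inr fun h' => ha (by rwa [ht' x a h])
  · change t x a = t y a
    by_cases ha : a ∈ F
    · apply SacksTree.ext_carrier
      rw [ht x a ha, ht y a ha, hr a x y h, hi a ha x y h]
    · rw [ht' x a ha, ht' y a ha, hr a x y h]
  · change (t x a).carrier ⊆ ((r x).tree a).carrier
    by_cases ha : a ∈ F
    · rw [ht x a ha]
      exact fun v hv => hv.1
    · rw [ht' x a ha]
  · change v ∈ (t x a).carrier at hv
    rw [ht x a ha] at hv
    exact hv.2

/-- The coordinates in the support of some member of the family. -/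
def familySupp {X : Type u} (g : X → SacksProduct κ A) : Set A :=
  {a | ∃ x, ((g x).tree a).carrier ≠ Set.univ}

/-- The coordinates that are active at the level `α`, given the families constructed earlier. -/
def activeCoords (e : Set A → κ.ord.ToType → Set A) (α : κ.ord.ToType)
    (f : Iio α → (κ.ord.ToType → A → Bool) → SacksProduct κ A) : Set A :=
  {a | Infinite (Iio α) ∧ ∃ β γ : Iio α, a ∈ e (familySupp (f β)) γ}

theorem mk_activeCoords_le {e : Set A → κ.ord.ToType → Set A}
    (he : ∀ U γ, (e U γ).Subsingleton) (α : κ.ord.ToType)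
    (f : Iio α → (κ.ord.ToType → A → Bool) → SacksProduct κ A) :
    #(activeCoords e α f) ≤ #(Iio α) * #(Iio α) := by
  rw [mul_def]
  have h : ∀ a : activeCoords e α f, ∃ q : Iio α × Iio α, a.1 ∈ e (familySupp (f q.1)) q.2 :=
    fun ⟨a, _, β, γ, h⟩ => ⟨(β, γ), h⟩
  choose q hq using h
  refine mk_le_of_injective (f := q) fun a b hab => Subtype.ext ?_
  refine he _ _ (hq a) ?_
  rw [hab]
  exact hq b

theorem activeCoords_eq_empty {e : Set A → κ.ord.ToType → Set A} {α : κ.ord.ToType}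
    {f : Iio α → (κ.ord.ToType → A → Bool) → SacksProduct κ A} (h : Finite (Iio α)) :
    activeCoords e α f = ∅ :=
  eq_empty_of_forall_notMem fun _ ha => not_finite_iff_infinite.2 ha.1 h

/-- One step of the construction of a fusion sequence. -/
structure IsFusionStep (p : SacksProduct κ A) (D : κ.ord.ToType → Set (SacksProduct κ A))
    (e : Set A → κ.ord.ToType → Set A) (α : κ.ord.ToType)
    (f : Iio α → ((κ.ord.ToType → A → Bool) → SacksProduct κ A) × Set A)
    (b : ((κ.ord.ToType → A → Bool) → SacksProduct κ A) × Set A) : Prop where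
  snd_eq : b.2 = activeCoords e α fun β => (f β).1
  exists_inf : ∃ r : (κ.ord.ToType → A → Bool) → SacksProduct κ A,
    (∀ x a, ((r x).tree a).carrier =
      {v | v ∈ (p.tree a).carrier ∧ ∀ β, v ∈ (((f β).1 x).tree a).carrier}) ∧
    (∀ x, b.1 x ≤ r x) ∧ ∀ a ∈ b.2, ∀ x, ∀ v ∈ ((b.1 x).tree a).carrier,
      v.IsInit (((r x).tree a).stem.snoc (x α a)) ∨ (((r x).tree a).stem.snoc (x α a)).IsInit v
  congr : ∀ a x y, (∀ δ : Iio α, a ∈ (f δ).2 → x δ a = y δ a) → (a ∈ b.2 → x α a = y α a) →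
    (b.1 x).tree a = (b.1 y).tree a
  mem : ∀ x, b.1 x ∈ D α

/-- Take the infimum of the earlier stages, cut each active coordinate to the side of its stem
chosen by `x α a`, then refine locally into `D α`. Here `rel a` means agreement on the bits that
coordinate `a` may depend on. -/
theorem exists_isFusionStep {p : SacksProduct κ A} {D : κ.ord.ToType → Set (SacksProduct κ A)}
    (hD : ∀ α, ∀ r ∈ D α, ∀ s ≤ r, s ∈ D α) (hdense : ∀ α, ∀ r ≤ p, ∃ s ≤ r, s ∈ D α)
    {e : Set A → κ.ord.ToType → Set A} (he : ∀ U γ, (e U γ).Subsingleton) (α : κ.ord.ToType)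
    (f : Iio α → ((κ.ord.ToType → A → Bool) → SacksProduct κ A) × Set A)
    (hf : ∀ γ : Iio α, IsFusionStep p D e γ
      (fun δ : Iio γ.1 => f ⟨δ.1, lt_trans (mem_Iio.1 δ.2) γ.2⟩) (f γ)) :
    ∃ b, IsFusionStep p D e α f b := by
  let F : Set A := activeCoords e α fun β => (f β).1
  have hFle : #F ≤ #(Iio α) * #(Iio α) := mk_activeCoords_le he α _
  have hFfin : Finite (Iio α) → F = ∅ := activeCoords_eq_empty
  have hsub : ∀ γ : Iio α, (f γ).2 ⊆ F := fun γ => by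
    rw [(hf γ).snd_eq]
    rintro a ⟨hinf, β, δ, h⟩
    exact ⟨Infinite.of_injective _ (inclusion_injective (Iio_subset_Iio γ.2.le)),
      ⟨β.1, lt_trans (mem_Iio.1 β.2) γ.2⟩, ⟨δ.1, lt_trans (mem_Iio.1 δ.2) γ.2⟩, h⟩
  let rel : A → (κ.ord.ToType → A → Bool) → (κ.ord.ToType → A → Bool) → Prop := fun a x y =>
    (∀ δ : Iio α, a ∈ (f δ).2 → x δ a = y δ a) ∧ (a ∈ F → x α a = y α a)
  have hrel : ∀ a, Equivalence (rel a) := fun a =>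
    ⟨fun x => ⟨fun _ _ => rfl, fun _ => rfl⟩,
      fun h => ⟨fun δ hδ => (h.1 δ hδ).symm, fun ha => (h.2 ha).symm⟩,
      fun h h' => ⟨fun δ hδ => (h.1 δ hδ).trans (h'.1 δ hδ), fun ha => (h.2 ha).trans (h'.2 ha)⟩⟩
  have hlep : ∀ (γ : Iio α) x, (f γ).1 x ≤ p := fun γ x a v hv => by
    obtain ⟨r, hr, hle, -⟩ := (hf γ).exists_inf
    have := hle x a hv
    rw [hr] at this
    exact this.1
  obtain ⟨r, hrl, hr⟩ := SacksProduct.exists_inf_local (rel := rel)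
    (mk_Iio_lt_of_inaccessible α) (g := fun _ => p) (f := fun γ => (f γ).1) hlep
    (fun β γ x h => by
      rcases h.lt_or_eq with h | rfl
      · intro a v hv
        obtain ⟨r, hr, hle, -⟩ := (hf γ).exists_inf
        have := hle x a hv
        rw [hr] at this
        exact this.2 ⟨β, h⟩
      · exact le_rfl) (fun _ _ _ _ => rfl)
    (fun γ a x y h => (hf γ).congr a x y (fun δ => h.1 _) fun ha => h.1 γ ha)
  have hα := mk_Iio_lt_of_inaccessible α
  obtain ⟨g, hgl, hgr, hg⟩ := SacksProduct.exists_cut hrl (F := F)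
    (hFle.trans (mul_lt_of_lt hκ.out.aleph0_lt.le hα hα).le) (fun x a => x α a)
    fun a ha x y h => h.2 ha
  let J := (#(supportedBranches α F)).ord.ToType
  obtain ⟨φ⟩ : Nonempty (J ≃ supportedBranches α F) := by
    rw [← Cardinal.eq, mk_ord_toType]
  obtain ⟨b, hbl, hbg, hbD⟩ := SacksProduct.exists_local_refinement hrel (J := J)
    (by rw [mk_ord_toType]; exact mk_supportedBranches_lt α F hFle hFfin)
    (fun j => (φ j).1) (fun x => by
      obtain ⟨y, hy, hxy⟩ := exists_supportedBranch α F x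
      refine ⟨φ.symm ⟨y, hy⟩, fun a => ?_⟩
      rw [φ.apply_symm_apply]
      exact ⟨fun δ hδ => hxy δ a δ.2.le (hsub δ hδ), fun ha => hxy α a le_rfl ha⟩)
    hgl (hD α) (fun x s hs => hdense α s (hs.trans ((hgr x).trans fun a v hv => by
      rw [hr] at hv
      exact hv.1)))
  exact ⟨(b, F), rfl, ⟨r, hr, fun x => (hbg x).trans (hgr x),
    fun a ha x v hv => hg a ha x v (hbg x a hv)⟩, fun a x y h h' => hbl a x y ⟨h, h'⟩, hbD⟩

/-- A fusion sequence below `p` that meets `D α` at the level `α`. Here `N α x` is the condition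
obtained at the level `α` along the branch `x`, it is chosen below `R α x`, the infimum of the
earlier conditions, and `F α` is the set of the coordinates that are split at the level `α`. -/
structure FusionSequence (p : SacksProduct κ A) (D : κ.ord.ToType → Set (SacksProduct κ A)) where
  N : κ.ord.ToType → (κ.ord.ToType → A → Bool) → SacksProduct κ A
  R : κ.ord.ToType → (κ.ord.ToType → A → Bool) → SacksProduct κ A
  F : κ.ord.ToType → Set A
  F_mono : ∀ α β, α ≤ β → F α ⊆ F β
  mk_F_le : ∀ α, #(F α) ≤ #(Iio α) * #(Iio α)
  F_eq_empty : ∀ α, Finite (Iio α) → F α = ∅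
  carrier_R : ∀ α x a, ((R α x).tree a).carrier =
    {v | v ∈ (p.tree a).carrier ∧ ∀ β < α, v ∈ ((N β x).tree a).carrier}
  N_le_R : ∀ α x, N α x ≤ R α x
  comparable : ∀ α, ∀ a ∈ F α, ∀ x, ∀ v ∈ ((N α x).tree a).carrier,
    v.IsInit (((R α x).tree a).stem.snoc (x α a)) ∨
      (((R α x).tree a).stem.snoc (x α a)).IsInit v
  congr : ∀ α a x y, (∀ δ ≤ α, a ∈ F δ → x δ a = y δ a) → (N α x).tree a = (N α y).tree a
  mem : ∀ α x, N α x ∈ D α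
  exists_active : ∀ α x a, ((N α x).tree a).carrier ≠ Set.univ → ∃ β, a ∈ F β

theorem exists_fusionSequence {p : SacksProduct κ A}
    {D : κ.ord.ToType → Set (SacksProduct κ A)}
    (hD : ∀ α, ∀ r ∈ D α, ∀ s ≤ r, s ∈ D α) (hdense : ∀ α, ∀ r ≤ p, ∃ s ≤ r, s ∈ D α) :
    Nonempty (FusionSequence p D) := by
  obtain ⟨e, he, he'⟩ := exists_enumeration κ A
  obtain ⟨f, hf⟩ := exists_forall_of_step (IsFusionStep p D e)
    (exists_isFusionStep hD hdense he)
  choose R hR hNR hcomp using fun α => (hf α).exists_inf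
  have hF := fun α => (hf α).snd_eq
  have hmono : ∀ α β, α ≤ β → (f α).2 ⊆ (f β).2 := fun α β h => by
    rw [hF, hF]
    rintro a ⟨hinf, γ, δ, ha⟩
    exact ⟨Infinite.of_injective _ (inclusion_injective (Iio_subset_Iio h)),
      ⟨γ.1, γ.2.trans_le h⟩, ⟨δ.1, δ.2.trans_le h⟩, ha⟩
  have hle : ∀ α, #(f α).2 ≤ #(Iio α) * #(Iio α) := fun α => by
    rw [hF]
    exact mk_activeCoords_le he _ _
  have hfin : ∀ α, Finite (Iio α) → (f α).2 = ∅ := fun α h => by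
    rw [hF, activeCoords_eq_empty h]
  have hcongr : ∀ α a x y, (∀ δ ≤ α, a ∈ (f δ).2 → x δ a = y δ a) →
      ((f α).1 x).tree a = ((f α).1 y).tree a := fun α a x y h =>
    (hf α).congr a x y (fun δ hδ => h δ δ.2.le hδ) fun ha => h α le_rfl ha
  -- There may be too many `x` for a union bound, but by locality the supported ones suffice, and
  -- these are fewer than `κ`.
  have hsupp : ∀ α, #(familySupp (f α).1) ≤ κ := fun α => by
    refine (mk_le_mk_of_subset (t := ⋃ x : supportedBranches α (f α).2, ((f α).1 x).supp) ?_).trans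
      (mk_iUnion_le_of_forall_le (mk_supportedBranches_lt α _ (hle α) (hfin α)).le _
        fun x => SacksProduct.mk_supp_le _)
    rintro a ⟨x, hx⟩
    obtain ⟨y, hy, hxy⟩ := exists_supportedBranch α (f α).2 x
    rw [hcongr α a x y fun δ hδ ha => hxy δ a hδ (hmono δ α hδ ha)] at hx
    exact mem_iUnion.2 ⟨⟨y, hy⟩, hx⟩
  refine ⟨⟨fun α => (f α).1, R, fun α => (f α).2, hmono, hle, hfin, fun α x a => ?_, hNR, hcomp,
    hcongr, fun α => (hf α).mem, fun α x a h => ?_⟩⟩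
  · rw [hR]
    ext v
    exact ⟨fun h => ⟨h.1, fun β hβ => h.2 ⟨β, hβ⟩⟩, fun h => ⟨h.1, fun β => h.2 β.1 β.2⟩⟩
  · obtain ⟨γ, hγ⟩ := he' _ (hsupp α) a ⟨x, h⟩
    have hinf : Infinite κ.ord.ToType := by
      rw [infinite_iff, mk_ord_toType]
      exact hκ.out.aleph0_lt.le
    -- Past `b` every level has infinitely many predecessors, as `activeCoords` requires.
    obtain ⟨b, hb⟩ := exists_forall_lt_of_mk_lt (J := ULift.{u} ℕ)
      (by simpa using hκ.out.aleph0_lt) fun n => Infinite.natEmbedding κ.ord.ToType n.down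
    obtain ⟨β, hβ⟩ := exists_gt (max (max α γ) b)
    refine ⟨β, ?_⟩
    rw [hF]
    refine ⟨Infinite.of_injective (fun n : ULift.{u} ℕ =>
      (⟨_, (hb n).trans ((le_max_right _ _).trans_lt hβ)⟩ : Iio β)) fun m n h => ?_,
      ⟨α, ((le_max_left _ _).trans (le_max_left _ _)).trans_lt hβ⟩,
      ⟨γ, ((le_max_right _ _).trans (le_max_left _ _)).trans_lt hβ⟩, hγ⟩
    exact ULift.ext _ _ ((Infinite.natEmbedding _).injective (congrArg Subtype.val h))

end

/-! ### The fusion and its predense sets -/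

section

variable {κ : Cardinal.{u}} [hκ : Fact κ.IsInaccessible] {A : Type u}

namespace FusionSequence

variable {p : SacksProduct κ A} {D : κ.ord.ToType → Set (SacksProduct κ A)}
  (S : FusionSequence p D)

theorem R_le (α : κ.ord.ToType) (x : κ.ord.ToType → A → Bool) : S.R α x ≤ p := fun a v hv => by
  rw [S.carrier_R] at hv
  exact hv.1

theorem R_le_N {α β : κ.ord.ToType} (h : β < α) (x : κ.ord.ToType → A → Bool) :
    S.R α x ≤ S.N β x := fun a v hv => by
  rw [S.carrier_R] at hv
  exact hv.2 β h

theorem R_congr (α : κ.ord.ToType) (a : A) (x y : κ.ord.ToType → A → Bool)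
    (h : ∀ δ < α, a ∈ S.F δ → x δ a = y δ a) : (S.R α x).tree a = (S.R α y).tree a := by
  apply SacksTree.ext_carrier
  rw [S.carrier_R, S.carrier_R]
  ext v
  refine and_congr_right fun _ => forall₂_congr fun β hβ => ?_
  rw [S.congr β a x y fun δ hδ => h δ (hδ.trans_lt hβ)]

/-- The stem in the coordinate `a` at the level `α`, along the branch `y`. -/
noncomputable def stemAt (a : A) (α : κ.ord.ToType) (y : κ.ord.ToType → Bool) : Node κ :=
  ((S.R α fun β _ => y β).tree a).stem

theorem snoc_stemAt_isInit {a : A} {α : κ.ord.ToType} (hα : a ∈ S.F α)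
    (y : κ.ord.ToType → Bool) {t : Node κ}
    (ht : Node.Splits ((S.N α fun β _ => y β).tree a).carrier t) :
    ((S.stemAt a α y).snoc (y α)).IsInit t :=
  SacksTree.isInit_of_splits_of_comparable (S.comparable α a hα fun β _ => y β) ht

/-- The splitting scheme in the coordinate `a`. -/
noncomputable def scheme {a : A} (ha : ∃ β, a ∈ S.F β) : SplittingScheme κ where
  C := {α | a ∈ S.F α}
  s := S.stemAt a
  unbounded b := by
    obtain ⟨β, hβ⟩ := ha
    obtain ⟨α, hα⟩ := exists_gt (max b β)
    exact ⟨α, S.F_mono β α ((le_max_right _ _).trans hα.le) hβ, (le_max_left _ _).trans_lt hα⟩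
  congr α _ y z h := by
    rw [stemAt, stemAt, S.R_congr α a (fun β _ => y β) (fun β _ => z β) fun δ hδ hδ' => h δ hδ' hδ]
  snoc_isInit α hα β _ h y :=
    S.snoc_stemAt_isInit hα y ((SacksTree.stem_splits _).mono (S.R_le_N h _ a))
  union := by
    rintro α - ⟨γ, hγ, hγα⟩ hlim y ξ hξ
    have hmono : ∀ δ ε, a ∈ S.F δ → δ < ε → (S.stemAt a δ y).IsInit (S.stemAt a ε y) :=
      fun δ ε hδ h => (Node.isInit_snoc _ _).trans
        (S.snoc_stemAt_isInit hδ y ((SacksTree.stem_splits _).mono (S.R_le_N h _ a)))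
    -- The union `t` of the earlier stems splits in every earlier `N β`, hence in `R α`; so the stem
    -- of `R α` is an initial segment of `t`.
    obtain ⟨t, ht, -⟩ := Node.exists_isUnion
      (N := (fun δ => S.stemAt a δ y) '' {δ | a ∈ S.F δ ∧ δ < α}) (b := (S.stemAt a α y).len) (by
      rintro _ ⟨δ, hδ, rfl⟩ _ ⟨ε, hε, rfl⟩
      rcases lt_trichotomy δ ε with h | rfl | h
      · exact .inl (hmono δ ε hδ.1 h)
      · exact .inl (.refl _)
      · exact .inr (hmono ε δ hε.1 h)) (by
      rintro _ ⟨δ, hδ, rfl⟩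
      exact (hmono δ α hδ.1 hδ.2).1)
    have hcof : ∀ β < α, ∃ δ, a ∈ S.F δ ∧ β < δ ∧ δ < α := fun β hβ => by
      obtain ⟨δ, hδ, h, hδα⟩ := hlim (max β γ) (S.F_mono γ _ (le_max_right _ _) hγ)
        (max_lt hβ hγα)
      exact ⟨δ, hδ, (le_max_left _ _).trans_lt h, hδα⟩
    have hN : ∀ β < α, Node.Splits ((S.N β fun β _ => y β).tree a).carrier t := fun β hβ => by
      refine SacksTree.splits_of_isUnion _
        (N := (fun δ => S.stemAt a δ y) '' {δ | a ∈ S.F δ ∧ δ < α ∧ β < δ}) ⟨?_, fun ζ hζ => ?_⟩ ?_ ?_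
      · rintro _ ⟨δ, hδ, rfl⟩
        exact ht.1 _ ⟨δ, ⟨hδ.1, hδ.2.1⟩, rfl⟩
      · obtain ⟨_, ⟨δ, hδ, rfl⟩, hlt⟩ := ht.2 ζ hζ
        obtain ⟨ε, hε, hmax, hεα⟩ := hcof (max β δ) (max_lt hβ hδ.2)
        exact ⟨_, ⟨ε, ⟨hε, hεα, (le_max_left _ _).trans_lt hmax⟩, rfl⟩,
          hlt.trans_le (hmono δ ε hδ.1 ((le_max_right _ _).trans_lt hmax)).1⟩
      · obtain ⟨δ, hδ, h, hδα⟩ := hcof β hβ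
        exact ⟨_, δ, ⟨hδ, hδα, h⟩, rfl⟩
      · rintro _ ⟨δ, hδ, rfl⟩
        exact (SacksTree.stem_splits _).mono (S.R_le_N hδ.2.2 _ a)
    have hsplit : Node.Splits ((S.R α fun β _ => y β).tree a).carrier t := fun i => by
      rw [S.carrier_R]
      exact ⟨((S.N_le_R γ _).trans (S.R_le γ _)) a (hN γ hγα i), fun β hβ => hN β hβ i⟩
    obtain ⟨_, ⟨δ, hδ, rfl⟩, hlt⟩ := ht.2 ξ (hξ.trans_le (SacksTree.stem_isInit_of_splits _ hsplit).1)
    exact ⟨δ, hδ.1, hδ.2, hlt⟩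

theorem mem_N_of_isInit {a : A} {α γ : κ.ord.ToType} (h : α < γ) {y : κ.ord.ToType → Bool}
    {v : Node κ} (hv : v.IsInit (S.stemAt a γ y)) :
    v ∈ ((S.N α fun β _ => y β).tree a).carrier :=
  SacksTree.init_mem _ _ (S.R_le_N h _ a (SacksTree.stem_mem _)) _ hv

theorem exists_fusion : ∃ q ≤ p, ∀ a,
    ∀ ha : ∃ β, a ∈ S.F β, (q.tree a).carrier = (S.scheme ha).carrier := by
  classical
  let t : A → SacksTree κ := fun a =>
    if ha : ∃ β, a ∈ S.F β then (S.scheme ha).toTree else p.tree a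
  have ht : ∀ a (ha : ∃ β, a ∈ S.F β), (t a).carrier = (S.scheme ha).carrier := fun a ha => by
    simp only [t, dif_pos ha]
    rfl
  refine ⟨⟨t, ?_⟩, fun a => ?_, ht⟩
  · refine (mk_le_mk_of_subset (t := (⋃ β, S.F β) ∪ p.supp) fun a ha => ?_).trans
      ((mk_union_le _ _).trans ((add_le_add (mk_iUnion_le_of_forall_le (by simp) _ fun β =>
        (S.mk_F_le β).trans (mul_lt_of_lt hκ.out.aleph0_lt.le (mk_Iio_lt_of_inaccessible β)
        (mk_Iio_lt_of_inaccessible β)).le) p.mk_supp_le).trans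
        (add_eq_self hκ.out.aleph0_lt.le).le))
    by_cases h : ∃ β, a ∈ S.F β
    · exact .inl (mem_iUnion.2 h)
    · refine .inr fun h' => ha ?_
      simp only [t, dif_neg h]
      exact h'
  · change (t a).carrier ⊆ _
    by_cases h : ∃ β, a ∈ S.F β
    · rw [ht a h]
      rintro v ⟨α, -, y, hv⟩
      exact (p.tree a).init_mem _ (S.R_le α _ a (SacksTree.stem_mem _)) _ hv
    · simp only [t, dif_neg h]
      exact Subset.rfl

/-- There are fewer than `κ` stems at level `α`, so some `v` in `T` is longer than all of them. It
fixes a branch `y` through level `α`, and by `agree` every extension of `v` in `T` follows `y` that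
far. -/
theorem exists_decided {a : A} {α : κ.ord.ToType} (hα : a ∈ S.F α) (T : SacksTree κ)
    (hT : T.carrier ⊆ (S.scheme ⟨α, hα⟩).carrier) :
    ∃ v ∈ T.carrier, ∃ y : κ.ord.ToType → Bool, ∀ w ∈ T.carrier, v.IsInit w →
      w ∈ ((S.N α fun β _ => y β).tree a).carrier := by
  obtain ⟨b, hb⟩ := exists_forall_lt_of_mk_lt
    (mk_supportedBranches_lt α (S.F α) (S.mk_F_le α) (S.F_eq_empty α))
    fun x => ((S.R α x.1).tree a).stem.len
  have hb' : ∀ y, (S.stemAt a α y).len < b := fun y => by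
    obtain ⟨x, hx, hyx⟩ := exists_supportedBranch α (S.F α) fun β _ => y β
    rw [stemAt, S.R_congr α a _ x fun δ hδ ha => hyx δ a hδ.le (S.F_mono δ α hδ.le ha)]
    exact hb ⟨x, hx⟩
  obtain ⟨r, hr⟩ := T.nonempty
  obtain ⟨v, hv, -, hbv⟩ := T.exists_lt_len hr b
  obtain ⟨γ, hγ, y, hvγ⟩ := hT hv
  refine ⟨v, hv, y, fun w hw hvw => ?_⟩
  obtain ⟨η, hη, z, hwη⟩ := hT hw
  have hag := SplittingScheme.agree (y := y) (α := Order.succ α) hη hwη fun δ hδ hδα => by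
    have hlen : ((S.scheme ⟨α, hα⟩).s δ y).len < v.len :=
      ((SplittingScheme.isInit_of_le hδ hα (Order.lt_succ_iff.1 hδα) y).1.trans_lt
        (hb' y)).trans hbv
    have hδγ : δ < γ := by
      by_contra! hle
      exact ((SplittingScheme.isInit_of_le hγ hδ hle y).1.trans_lt hlen).not_ge hvγ.1
    exact (((S.scheme ⟨α, hα⟩).snoc_isInit δ hδ γ hγ hδγ y).of_common hvγ
      (Order.succ_le_of_lt hlen)).trans hvw
  rw [S.congr α a _ (fun β _ => z β) fun δ hδ ha => (hag δ ha (Order.lt_succ_iff.2 hδ)).2]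
  exact S.mem_N_of_isInit (hag α hα (Order.lt_succ α)).1 hwη

/-- Cut `r` to the cone of a deciding node in each coordinate of `F α`, and let `x` combine the
branches so obtained. The support stays small because `F α` is. -/
theorem exists_compatible {q : SacksProduct κ A}
    (hq : ∀ a, ∀ ha : ∃ β, a ∈ S.F β, (q.tree a).carrier = (S.scheme ha).carrier)
    (α : κ.ord.ToType) {r : SacksProduct κ A} (hr : r ≤ q) : ∃ x, Compatible r (S.N α x) := by
  classical
  have key : ∀ a : A, ∃ v ∈ (r.tree a).carrier, ∃ y : κ.ord.ToType → Bool, a ∈ S.F α →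
      ∀ w ∈ (r.tree a).carrier, v.IsInit w → w ∈ ((S.N α fun β _ => y β).tree a).carrier := by
    intro a
    by_cases ha : a ∈ S.F α
    · obtain ⟨v, hv, y, h⟩ := S.exists_decided ha (r.tree a) (by
        rw [← hq]
        exact hr a)
      exact ⟨v, hv, y, fun _ => h⟩
    · obtain ⟨v, hv⟩ := (r.tree a).nonempty
      exact ⟨v, hv, fun _ => false, fun h => (ha h).elim⟩
  choose v hv y hy using key
  -- Coordinates not yet active need no cut: if one is active later, its tree in `N α x` does not
  -- depend on `x` and contains all later stems; if never, that tree is full.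
  have hrN : ∀ x, ∀ a ∉ S.F α, (r.tree a).carrier ⊆ ((S.N α x).tree a).carrier := by
    intro x a ha w hw
    by_cases h : ∃ β, a ∈ S.F β
    · have hwq := hr a hw
      rw [hq a h] at hwq
      obtain ⟨γ, hγ, z, hwγ⟩ := hwq
      have hαγ : α < γ := lt_of_not_ge fun hle => ha (S.F_mono γ α hle hγ)
      rw [S.congr α a x (fun β _ => z β) fun δ hδ hδ' => (ha (S.F_mono δ α hδ hδ')).elim]
      exact S.mem_N_of_isInit hαγ hwγ
    · have : ((S.N α x).tree a).carrier = Set.univ := by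
        by_contra hc
        exact h (S.exists_active α x a hc)
      rw [this]
      trivial
  let t : A → SacksTree κ := fun a => if a ∈ S.F α then (r.tree a).cone (v a) (hv a) else r.tree a
  have ht : ∀ a ∈ S.F α, (t a).carrier =
      {w ∈ (r.tree a).carrier | w.IsInit (v a) ∨ (v a).IsInit w} := fun a ha => by
    simp only [t, if_pos ha]
    rfl
  have ht' : ∀ a ∉ S.F α, t a = r.tree a := fun a ha => if_neg ha
  refine ⟨fun δ a => y a δ, ⟨t, ?_⟩, fun a => ?_, fun a => ?_⟩
  · refine (mk_le_mk_of_subset (t := S.F α ∪ r.supp) fun a ha => ?_).trans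
      ((mk_union_le _ _).trans ((add_le_add ((S.mk_F_le α).trans
        (mul_lt_of_lt hκ.out.aleph0_lt.le (mk_Iio_lt_of_inaccessible α)
        (mk_Iio_lt_of_inaccessible α)).le) r.mk_supp_le).trans
        (add_eq_self hκ.out.aleph0_lt.le).le))
    by_cases h : a ∈ S.F α
    · exact .inl h
    · exact .inr fun h' => ha (by rwa [ht' a h])
  · change (t a).carrier ⊆ _
    by_cases ha : a ∈ S.F α
    · rw [ht a ha]
      exact fun w hw => hw.1
    · rw [ht' a ha]
  · change (t a).carrier ⊆ _
    by_cases ha : a ∈ S.F α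
    · rw [ht a ha, S.congr α a _ (fun β _ => y a β) fun _ _ _ => rfl]
      rintro w ⟨hw, h | h⟩
      · exact SacksTree.init_mem _ _ (hy a ha _ (hv a) (.refl _)) _ h
      · exact hy a ha w hw h
    · rw [ht' a ha]
      exact hrN _ a ha

end FusionSequence

/-- Below every condition there is a condition `q` such that, for all `α`, some at most `2 ^ |α|`
members of the dense open set `D α` form a predense set below `q`. -/
theorem exists_predenseBelow {p : SacksProduct κ A}
    {D : κ.ord.ToType → Set (SacksProduct κ A)}
    (hD : ∀ α, ∀ r ∈ D α, ∀ s ≤ r, s ∈ D α) (hdense : ∀ α, ∀ r ≤ p, ∃ s ≤ r, s ∈ D α) :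
    ∃ q ≤ p, ∀ α, ∃ B ⊆ D α, #B ≤ 2 ^ #(Iio α) ∧ PredenseBelow B q := by
  obtain ⟨S⟩ := exists_fusionSequence hD hdense
  obtain ⟨q, hqp, hq⟩ := S.exists_fusion
  refine ⟨q, hqp, fun α => ⟨S.N α '' supportedBranches α (S.F α), ?_, mk_image_le.trans
    (mk_supportedBranches_le α _ (S.mk_F_le α) (S.F_eq_empty α)), fun r hr => ?_⟩⟩
  · rintro _ ⟨x, -, rfl⟩
    exact S.mem α x
  · obtain ⟨x, hx⟩ := S.exists_compatible hq α hr
    obtain ⟨y, hy, hxy⟩ := exists_supportedBranch α (S.F α) x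
    refine ⟨_, ⟨y, hy, rfl⟩, ?_⟩
    rwa [← SacksProduct.ext_tree fun a => S.congr α a x y fun δ hδ ha =>
      hxy δ a hδ (S.F_mono δ α hδ ha)]

end

/-! ### Basic facts about the forcing relation -/

section Forcing

variable {P : Type u} [Preorder P]

theorem ForcesEq.mono {σ τ : PName P} {p q : P} (h : ForcesEq σ τ p) (hq : q ≤ p) :
    ForcesEq σ τ q := by
  cases σ
  cases τ
  simp only [ForcesEq] at h ⊢
  exact ⟨fun i r hr => h.1 i r (hr.trans hq), fun j r hr => h.2 j r (hr.trans hq)⟩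

theorem ForcesEq.refl (σ : PName P) (p : P) : ForcesEq σ σ p := by
  induction σ generalizing p with
  | mk ι name cond ih =>
    simp only [ForcesEq]
    exact ⟨fun i q _ hq => ⟨q, le_rfl, i, hq, ih i q⟩, fun i q _ hq => ⟨q, le_rfl, i, hq, ih i q⟩⟩

theorem ForcesMem.mono {σ τ : PName P} {p q : P} (h : ForcesMem σ τ p) (hq : q ≤ p) :
    ForcesMem σ τ q := by
  cases τ
  simp only [ForcesMem] at h ⊢
  exact fun r hr => h r (hr.trans hq)

theorem forcesMem_check_iff {σ : PName P} {a : ZFSet.{u}} {p : P} :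
    ForcesMem σ (check a) p ↔ ∀ q ≤ p, ∃ r ≤ q, ∃ v ∈ a, ForcesEq σ (check v) r := by
  rw [check]
  simp only [ForcesMem]
  refine forall₂_congr fun q _ => exists_congr fun r => and_congr_right fun _ => ⟨?_, ?_⟩
  · rintro ⟨j, -, h⟩
    exact ⟨_, ((equivShrink a).symm j.1).2, h⟩
  · rintro ⟨v, hv, h⟩
    refine ⟨(equivShrink a ⟨v, hv⟩, r), le_rfl, ?_⟩
    simpa using h

end Forcing

/-! ### Localization of names and antichains -/

section

variable {κ : Cardinal.{u}} [hκ : Fact κ.IsInaccessible] {A : Type u}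

/-- The ordinal represented by an element of `κ.ord.ToType`. -/
noncomputable def ordOf (i : κ.ord.ToType) : Ordinal.{u} := (Ordinal.ToType.mk.symm i).1

theorem ordOf_lt (i : κ.ord.ToType) : ordOf i < κ.ord := (Ordinal.ToType.mk.symm i).2

theorem ordOf_injective : Function.Injective (ordOf : κ.ord.ToType → Ordinal.{u}) :=
  Subtype.val_injective.comp Ordinal.ToType.mk.symm.injective

theorem exists_ordOf_eq {α : Ordinal.{u}} (hα : α < κ.ord) :
    ∃ i : κ.ord.ToType, ordOf i = α :=
  ⟨Ordinal.ToType.mk ⟨α, hα⟩, by simp [ordOf]⟩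

theorem mk_Iio_eq_card_ordOf (i : κ.ord.ToType) : #(Iio i) = (ordOf i).card := by
  have e : Iio i ≃ Iio (ordOf i) :=
    { toFun := fun j => ⟨ordOf j.1, Ordinal.ToType.mk.symm.lt_iff_lt.2 j.2⟩
      invFun := fun β => ⟨Ordinal.ToType.mk ⟨β.1, lt_trans (mem_Iio.1 β.2) (ordOf_lt i)⟩, by
        rw [mem_Iio, ← Ordinal.ToType.mk.symm.lt_iff_lt]
        rw [OrderIso.symm_apply_apply]
        exact mem_Iio.1 β.2⟩
      left_inv := fun j => by simp [ordOf]
      right_inv := fun β => Subtype.ext (by simp [ordOf]) }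
  have h := mk_congr_lift e
  rw [Cardinal.mk_Iio_ordinal, lift_lift, ← lift_umax.{u, u + 1}, lift_inj] at h
  exact h

/-- Localization of a name for a function on `κ` whose values are forced to be among the ground
model sets `val w`. -/
theorem exists_localization {W : Type*} (val : W → ZFSet.{u}) {p : SacksProduct κ A}
    {f : PName (SacksProduct κ A)} {B : PName (SacksProduct κ A) → SacksProduct κ A → Prop}
    (hB : ∀ y r, B y r → ∃ s ≤ r, ∃ w, ForcesEq y (check (val w)) s)
    (hf : ForcesFunction f (check κ.ord.toZFSet) B p) :
    ∃ q ≤ p, ∀ i : κ.ord.ToType, ∃ S : Set (SacksProduct κ A), #S ≤ 2 ^ (ordOf i).card ∧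
      ∃ w : S → W, ∀ φ : ZFSet.{u}, (∀ s, val (w s) ∈ φ) →
        ForcesValueMem f (check (ordOf i).toZFSet) (check φ) q := by
  let D : κ.ord.ToType → Set (SacksProduct κ A) := fun i => {r | ∃ w y,
    ForcesEq y (check (val w)) r ∧ ForcesMem (opName (check (ordOf i).toZFSet) y) f r}
  have hD : ∀ i, ∀ r ∈ D i, ∀ s ≤ r, s ∈ D i := fun i r ⟨w, y, h1, h2⟩ s hs =>
    ⟨w, y, h1.mono hs, h2.mono hs⟩
  have hdense : ∀ i, ∀ r ≤ p, ∃ s ≤ r, s ∈ D i := fun i r hr => by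
    -- Only the totality clause of `ForcesFunction` is used; `hB` then decides the value.
    obtain ⟨s, hs, y, hy, hmem⟩ := hf.2.2 (check (ordOf i).toZFSet) p le_rfl
      (forcesMem_check_iff.2 fun q _ => ⟨q, le_rfl, _,
        Ordinal.toZFSet_mem_toZFSet_iff.2 (ordOf_lt i), .refl _ _⟩) r hr
    obtain ⟨s', hs', w, hw⟩ := hB y s hy
    exact ⟨s', hs'.trans hs, w, y, hw, hmem.mono hs'⟩
  obtain ⟨q, hqp, hq⟩ := exists_predenseBelow hD hdense
  refine ⟨q, hqp, fun i => ?_⟩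
  obtain ⟨S, hS, hcard, hpre⟩ := hq i
  choose w y hw hy using fun s : S => hS s.2
  rw [mk_Iio_eq_card_ordOf] at hcard
  refine ⟨S, hcard, w, fun φ hφ r hr => ?_⟩
  obtain ⟨b, hb, s, hsr, hsb⟩ := hpre r hr
  exact ⟨s, hsr, y ⟨b, hb⟩, forcesMem_check_iff.2 fun t ht => ⟨t, le_rfl, _, hφ ⟨b, hb⟩,
    (hw ⟨b, hb⟩).mono (ht.trans hsb)⟩, (hy ⟨b, hb⟩).mono hsb⟩

/-- Pads the set of possible values to the exact size demanded of a slalom; the complement of a set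
smaller than `κ` has room for it. -/
theorem exists_superset_mk_eq {s : Set κ.ord.ToType} {c : Cardinal.{u}} (hs : #s ≤ c)
    (hc : c < κ) : ∃ t, s ⊆ t ∧ #t = c := by
  obtain ⟨k, rfl⟩ := exists_add_of_le hs
  have hk : k ≤ #(sᶜ : Set κ.ord.ToType) := by
    by_contra! h
    have h1 := mk_sum_compl s
    rw [mk_ord_toType] at h1
    exact (add_lt_of_lt hκ.out.aleph0_lt.le (hs.trans_lt hc)
      (h.trans ((self_le_add_left _ _).trans_lt hc))).ne h1
  obtain ⟨t, ht, rfl⟩ := le_mk_iff_exists_subset.1 hk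
  exact ⟨s ∪ t, subset_union_left,
    mk_union_of_disjoint (disjoint_left.2 fun _ hx hx' => ht hx' hx)⟩

theorem card_range_of_injective {ι : Type u} {f : ι → ZFSet.{u}} (hf : Function.Injective f) :
    (ZFSet.range f).card = #ι := by
  rw [← lift_inj.{u, u + 1}, ← ZFSet.cardinalMk_coe_sort]
  have h := mk_range_eq_of_injective hf
  rw [← ZFSet.coe_range, lift_id'.{u, u + 1}] at h
  exact h

theorem two_power_card_lt {α : Ordinal.{u}} (hα : α < κ.ord) :
    (2 : Cardinal.{u}) ^ α.card < κ :=
  hκ.out.isStrongPrelimit (lt_ord.1 hα)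

theorem hasGeneralizedSacksProperty :
    HasGeneralizedSacksProperty κ powerFun (SacksProduct κ A) where
  lt_ord α hα := by
    rw [powerFun, ord_lt_ord]
    exact two_power_card_lt hα
  tendsto β hβ := by
    -- The threshold is `β` itself: by Cantor, `|β| < 2 ^ |β| ≤ 2 ^ |α|`.
    refine ⟨β, hβ, fun α _ h => ?_⟩
    rw [powerFun]
    refine le_of_lt (lt_ord.2 ?_)
    exact (cantor _).trans_le (power_le_power_left two_ne_zero (Ordinal.card_le_card h))
  localize p f hf := by
    obtain ⟨q, hqp, hq⟩ := exists_localization (fun i : κ.ord.ToType => (ordOf i).toZFSet)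
      (fun y r hr => by
        obtain ⟨s, hs, v, hv, h⟩ := forcesMem_check_iff.1 hr r le_rfl
        obtain ⟨α, hα, rfl⟩ := Ordinal.mem_toZFSet_iff.1 hv
        obtain ⟨i, rfl⟩ := exists_ordOf_eq hα
        exact ⟨s, hs, i, h⟩) hf
    have key : ∀ α : Ordinal.{u}, ∃ φ : ZFSet.{u}, α < κ.ord →
        (φ ⊆ κ.ord.toZFSet ∧ φ.card = (powerFun α).card) ∧
          ForcesValueMem f (check α.toZFSet) (check φ) q := by
      intro α
      by_cases hα : α < κ.ord
      · obtain ⟨i, rfl⟩ := exists_ordOf_eq hα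
        obtain ⟨S, hS, w, hw⟩ := hq i
        obtain ⟨t, hst, ht⟩ := exists_superset_mk_eq (mk_range_le.trans hS)
          (two_power_card_lt hα)
        refine ⟨ZFSet.range fun j : t => (ordOf j.1).toZFSet, fun _ => ⟨⟨?_, ?_⟩, hw _ ?_⟩⟩
        · intro v hv
          obtain ⟨j, rfl⟩ := ZFSet.mem_range.1 hv
          exact Ordinal.toZFSet_mem_toZFSet_iff.2 (ordOf_lt _)
        · rw [card_range_of_injective fun j k h => Subtype.ext
            (ordOf_injective (Ordinal.toZFSet_injective h)), ht, powerFun, card_ord]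
        · exact fun s => ZFSet.mem_range.2 ⟨⟨w s, hst (mem_range_self s)⟩, rfl⟩
      · exact ⟨∅, fun h => (hα h).elim⟩
    choose φ hφ using key
    exact ⟨q, hqp, φ, fun α hα => (hφ α hα).1, fun α hα => (hφ α hα).2⟩

theorem exists_ground_localization (p : SacksProduct κ A) (f : PName (SacksProduct κ A))
    (hf : ForcesFunction f (check κ.ord.toZFSet) ForcesGround p) :
    ∃ q ≤ p, ∃ φ : Ordinal.{u} → ZFSet.{u},
      (∀ α < κ.ord, (φ α).card ≤ 2 ^ α.card) ∧
      ∀ α < κ.ord, ForcesValueMem f (check α.toZFSet) (check (φ α)) q := by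
  obtain ⟨q, hqp, hq⟩ := exists_localization (fun v : ZFSet.{u} => v)
    (fun y r hr => hr r le_rfl) hf
  have key : ∀ α : Ordinal.{u}, ∃ φ : ZFSet.{u}, α < κ.ord → φ.card ≤ 2 ^ α.card ∧
      ForcesValueMem f (check α.toZFSet) (check φ) q := by
    intro α
    by_cases hα : α < κ.ord
    · obtain ⟨i, rfl⟩ := exists_ordOf_eq hα
      obtain ⟨S, hS, w, hw⟩ := hq i
      have h := ZFSet.lift_card_range_le (f := w)
      rw [lift_id, lift_id] at h
      exact ⟨ZFSet.range w, fun _ => ⟨h.trans hS, hw _ ZFSet.mem_range_self⟩⟩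
    · exact ⟨∅, fun h => (hα h).elim⟩
  choose φ hφ using key
  exact ⟨q, hqp, φ, fun α hα => (hφ α hα).1, fun α hα => (hφ α hα).2⟩

theorem IsMaximalAntichain.exists_compatible {P : Type u} [Preorder P] {S : Set P}
    (hS : IsMaximalAntichain S) (p : P) : ∃ a ∈ S, Compatible p a := by
  by_contra! h
  have hanti : IsForcingAntichain (insert p S) := by
    rintro a (rfl | ha) b (rfl | hb) hab
    · exact (hab rfl).elim
    · exact h b hb
    · exact fun ⟨r, h1, h2⟩ => h a ha ⟨r, h2, h1⟩
    · exact hS.1 a ha b hb hab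
  exact h p (hS.2 hanti (subset_insert p S) (mem_insert p S)) ⟨p, le_rfl, le_rfl⟩

theorem exists_small_predense (p : SacksProduct κ A)
    (𝒜 : Ordinal.{u} → Set (SacksProduct κ A))
    (h𝒜 : ∀ α < κ.ord, IsMaximalAntichain (𝒜 α)) :
    ∃ q ≤ p, ∃ ℬ : Ordinal.{u} → Set (SacksProduct κ A), ∀ α < κ.ord,
      ℬ α ⊆ 𝒜 α ∧ #(ℬ α) ≤ 2 ^ α.card ∧ PredenseBelow (ℬ α) q := by
  obtain ⟨q, hqp, hq⟩ := exists_predenseBelow (p := p)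
    (D := fun i => {r | ∃ a ∈ 𝒜 (ordOf i), r ≤ a})
    (fun i r ⟨a, ha, hra⟩ s hs => ⟨a, ha, hs.trans hra⟩) (fun i r _ => by
      obtain ⟨a, ha, s, hsr, hsa⟩ := (h𝒜 _ (ordOf_lt i)).exists_compatible r
      exact ⟨s, hsr, a, ha, hsa⟩)
  have key : ∀ α : Ordinal.{u}, ∃ ℬ : Set (SacksProduct κ A), α < κ.ord →
      ℬ ⊆ 𝒜 α ∧ #ℬ ≤ 2 ^ α.card ∧ PredenseBelow ℬ q := by
    intro α
    by_cases hα : α < κ.ord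
    · obtain ⟨i, rfl⟩ := exists_ordOf_eq hα
      obtain ⟨S, hS, hcard, hpre⟩ := hq i
      choose a ha hle using fun s : S => hS s.2
      rw [mk_Iio_eq_card_ordOf] at hcard
      refine ⟨range a, fun _ => ⟨?_, mk_range_le.trans hcard, fun r hr => ?_⟩⟩
      · rintro _ ⟨s, rfl⟩
        exact ha s
      · obtain ⟨b, hb, s, hsr, hsb⟩ := hpre r hr
        exact ⟨_, ⟨⟨b, hb⟩, rfl⟩, s, hsr, hsb.trans (hle ⟨b, hb⟩)⟩
    · exact ⟨∅, fun h => (hα h).elim⟩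
  choose ℬ hℬ using key
  exact ⟨q, hqp, ℬ, hℬ⟩

end

end GenSacks

theorem mainTheorem5 (κ : Cardinal.{u}) (hκ : κ.IsInaccessible) (A : Type u) :
    GenSacks.HasGeneralizedSacksProperty κ GenSacks.powerFun (GenSacks.SacksProduct κ A) ∧
    (∀ (p : GenSacks.SacksProduct κ A) (f : GenSacks.PName (GenSacks.SacksProduct κ A)),
      GenSacks.ForcesFunction f (GenSacks.check κ.ord.toZFSet) GenSacks.ForcesGround p →
      ∃ q ≤ p, ∃ φ : Ordinal.{u} → ZFSet.{u},
        (∀ α < κ.ord, (φ α).card ≤ 2 ^ α.card) ∧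
        ∀ α < κ.ord,
          GenSacks.ForcesValueMem f (GenSacks.check α.toZFSet) (GenSacks.check (φ α)) q) ∧
    (∀ (p : GenSacks.SacksProduct κ A) (𝒜 : Ordinal.{u} → Set (GenSacks.SacksProduct κ A)),
      (∀ α < κ.ord, GenSacks.IsMaximalAntichain (𝒜 α)) →
      ∃ q ≤ p, ∃ ℬ : Ordinal.{u} → Set (GenSacks.SacksProduct κ A),
        ∀ α < κ.ord, ℬ α ⊆ 𝒜 α ∧ Cardinal.mk (ℬ α) ≤ 2 ^ α.card ∧
          GenSacks.PredenseBelow (ℬ α) q) := by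
  have : Fact κ.IsInaccessible := ⟨hκ⟩
  exact ⟨GenSacks.hasGeneralizedSacksProperty, GenSacks.exists_ground_localization,
    GenSacks.exists_small_predense⟩
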